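/- Let $\mathcal C$ be a class of finite simple graphs of bounded twin-width, i.e. there is $d$ such that every $G\in\mathcal C$ admits a $d$-sequence (a sequence of trigraphs of red degree at most $d$ that starts at $G$, ends at a single vertex, and in which each trigraph arises from the previous one by contracting two vertices). Consider the following two problems, parameterized by $k$. * *Connected $k$-Vertex Cover*: given a graph $G$ and an integer $k\ge 0$, does $G$ have a vertex cover $S$ with $|S|\le k$ such that $G[S]$ is connected (in particular $S\neq\emptyset$)? * *Capacitated $k$-Vertex Cover*: given a graph $G$, a capacity function $c:V(G)\to\mathbb N$ and an integer $k\ge 0$, does $G$ have a vertex cover $S$ with $|S|\le k$ for which there is a map $\rho:E(G)\to S$ with $\rho(e)\in e$ for all $e\in E(G)$ and $|\rho^{-1}(v)|\le c(v)$ for all $v\in S$? Then on $\mathcal C$ each of the two problems has a kernel with $O(k^2)$ vertices: for each of them there are a constant $C$, a polynomial $p$ (both depending only on $\mathcal C$ and the problem) and a map $\rho$ from instances to instances, computable in polynomial time from the instance alone (graph given by its adjacency matrix, numbers in binary, no contraction sequence), such that every instance with parameter $k$ whose graph $G$ belongs to $\mathcal C$ is mapped by $\rho$ to an instance with graph $G'$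 and parameter $k'$ such that the output is a yes-instance if and only if the input is one, $k'\le k$, $|V(G')|\le C(k^2+1)$, the total encoding length of the output (including the capacities) is at most $p(k)$, and $G'$ is isomorphic to an induced subgraph of $G$ (so that $G'$ lies in $\mathcal C$ whenever $\mathcal C$ is closed under isomorphism and induced subgraphs, and always $\operatorname{tww}(G')\le \operatorname{tww}(G)$). -/

import Mathlib

/-! ### Trigraphs, contraction sequences and twin-width -/

/-- A trigraph: a vertex set with disjoint sets of black and red edges. -/
structure Trigraph (V : Type) where
  black : SimpleGraph V
  red : SimpleGraph V
  disjoint : Disjoint black red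

namespace Trigraph

/-- `x` and `y` are joined by a black or a red edge. -/
def TotalAdj {V : Type} (H : Trigraph V) (x y : V) : Prop :=
  H.black.Adj x y ∨ H.red.Adj x y

/-- Every vertex is incident with at most `d` red edges. -/
def RedDegreeLE {V : Type} (H : Trigraph V) (d : ℕ) : Prop :=
  ∀ v : V, (H.red.neighborSet v).ncard ≤ d

/-- A graph seen as a trigraph without red edges. -/
def ofGraph {V : Type} (G : SimpleGraph V) : Trigraph V where
  black := G
  red := ⊥
  disjoint := disjoint_bot_right

/-- `H'` is obtained from `H` by contracting the distinct vertices `u` and `v` into the single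
vertex `π u = π v`; the map `π` sends each vertex of `H` to the vertex of `H'` it becomes. -/
structure IsContraction {V W : Type} (H : Trigraph V) (H' : Trigraph W) (u v : V) (π : V → W) :
    Prop where
  ne : u ≠ v
  surjective : Function.Surjective π
  identify : ∀ x y, π x = π y ↔ x = y ∨ (x = u ∧ y = v) ∨ (x = v ∧ y = u)
  /-- Edges not incident to `u` or `v` are unchanged. -/
  black_rest : ∀ x y, x ≠ u → x ≠ v → y ≠ u → y ≠ v →
    (H'.black.Adj (π x) (π y) ↔ H.black.Adj x y)
  red_rest : ∀ x y, x ≠ u → x ≠ v → y ≠ u → y ≠ v →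
    (H'.red.Adj (π x) (π y) ↔ H.red.Adj x y)
  /-- The new vertex has a black edge to `x` when both `ux` and `vx` are black edges. -/
  black_new : ∀ x, x ≠ u → x ≠ v →
    (H'.black.Adj (π u) (π x) ↔ H.black.Adj u x ∧ H.black.Adj v x)
  /-- The new vertex has a red edge to every other neighbor of `u` or `v`. -/
  red_new : ∀ x, x ≠ u → x ≠ v →
    (H'.red.Adj (π u) (π x) ↔
      (H.TotalAdj u x ∨ H.TotalAdj v x) ∧ ¬ (H.black.Adj u x ∧ H.black.Adj v x))

/-- `H` has a `d`-sequence: a sequence of trigraphs of red degree at most `d`, starting at `H`,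
each obtained from the previous one by a single contraction, ending at a single vertex.
(By convention the trigraph without vertices has the trivial sequence.) -/
inductive HasSequence (d : ℕ) : (n : ℕ) → Trigraph (Fin n) → Prop
  | base {n : ℕ} (H : Trigraph (Fin n)) (hn : n ≤ 1) : HasSequence d n H
  | step {n : ℕ} (H : Trigraph (Fin (n + 1))) (H' : Trigraph (Fin n))
      (u v : Fin (n + 1)) (π : Fin (n + 1) → Fin n)
      (hdeg : H.RedDegreeLE d) (hcontr : H.IsContraction H' u v π)
      (hseq : HasSequence d n H') : HasSequence d (n + 1) H

end Trigraph

/-- A finite simple graph, with vertex set `{0, …, n - 1}`. -/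
structure FinGraph where
  n : ℕ
  graph : SimpleGraph (Fin n)

namespace FinGraph

/-- The twin-width of `G` is at most `d`: `G` admits a `d`-sequence. -/
def TwinWidthLE (G : FinGraph) (d : ℕ) : Prop :=
  Trigraph.HasSequence d G.n (Trigraph.ofGraph G.graph)

end FinGraph

/-- A class of finite graphs of bounded twin-width. -/
def BoundedTwinWidth (𝒞 : Set FinGraph) : Prop :=
  ∃ d : ℕ, ∀ G ∈ 𝒞, G.TwinWidthLE d

/-! ### Parameterized graph problems and kernels -/

/-- A parameterized problem on (possibly annotated) finite graphs. Each instance has an underlying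
graph and a parameter, and is written as a word over the alphabet `{0, 1, separator}`. -/
structure GraphProblem where
  Inst : Type
  graph : Inst → FinGraph
  param : Inst → ℕ
  encode : Inst → List (Option Bool)
  encode_injective : Function.Injective encode
  /-- The positive instances. -/
  Yes : Inst → Prop

/-- `ρ` is a kernelization of the problem `P` on the class `𝒞`, with at most `bound k` vertices:
a polynomial-time map from instances to instances which, on the instances with parameter `k` whose
graph is in `𝒞`, outputs an equivalent instance with parameter at most `k`, with at most `bound k`
vertices, and with total bit size polynomial in `k`. The output graph is (up to isomorphism) an
induced subgraph of the input graph; in particular it stays in every hereditary class that contains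
the input graph, and its twin-width is not larger. -/
structure GraphProblem.IsKernel (P : GraphProblem) (𝒞 : Set FinGraph) (bound : ℕ → ℕ)
    (ρ : P.Inst → P.Inst) : Prop where
  polytime : Nonempty (Turing.TM2ComputableInPolyTime P.encode P.encode ρ)
  equivalent : ∀ x, P.graph x ∈ 𝒞 → (P.Yes (ρ x) ↔ P.Yes x)
  param_le : ∀ x, P.graph x ∈ 𝒞 → P.param (ρ x) ≤ P.param x
  vertices_le : ∀ x, P.graph x ∈ 𝒞 → (P.graph (ρ x)).n ≤ bound (P.param x)
  size_le : ∃ p : Polynomial ℕ, ∀ x, P.graph x ∈ 𝒞 →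
    (P.encode (ρ x)).length ≤ p.eval (P.param x)
  induced : ∀ x, P.graph x ∈ 𝒞 → Nonempty ((P.graph (ρ x)).graph ↪g (P.graph x).graph)

/-- `P` admits on the class `𝒞` a kernel with `O(k ^ 2)` vertices. -/
def GraphProblem.AdmitsQuadraticVertexKernel (P : GraphProblem) (𝒞 : Set FinGraph) : Prop :=
  ∃ (C : ℕ) (ρ : P.Inst → P.Inst), P.IsKernel 𝒞 (fun k => C * (k ^ 2 + 1)) ρ

/-! ### Encoding of instances -/

/-- Write a list of binary words, each one followed by a separator. -/
def encodeBlocks (L : List (List Bool)) : List (Option Bool) :=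
  L.flatMap fun b => b.map some ++ [none]

theorem encodeBlocks_injective : Function.Injective encodeBlocks := by
  have key : ∀ (b b' : List Bool) (s s' : List (Option Bool)),
      b.map some ++ none :: s = b'.map some ++ none :: s' → b = b' ∧ s = s' := by
    intro b
    induction b with
    | nil => intro b' s s' h; cases b' <;> simp_all
    | cons a b ih =>
      intro b' s s' h
      cases b' with
      | nil => simp at h
      | cons a' b' =>
        simp only [List.map_cons, List.cons_append, List.cons.injEq, Option.some.injEq] at h
        obtain ⟨h1, h2⟩ := ih b' s s' h.2
        exact ⟨by rw [h.1, h1], h2⟩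
  intro L
  induction L with
  | nil => intro L' h; cases L' <;> simp_all [encodeBlocks]
  | cons b L ih =>
    intro L' h
    cases L' with
    | nil => simp [encodeBlocks] at h
    | cons b' L' =>
      simp only [encodeBlocks, List.flatMap_cons, List.append_assoc, List.cons_append,
        List.nil_append] at h
      obtain ⟨h1, h2⟩ := key b b' _ _ h
      rw [h1, ih h2]

open Classical in
/-- The row of the vertex `i` in the adjacency matrix of `G`. -/
noncomputable def adjRow {n : ℕ} (G : SimpleGraph (Fin n)) (i : Fin n) : List Bool :=
  List.ofFn fun j => decide (G.Adj i j)

theorem adjRow_injective {n : ℕ} {G G' : SimpleGraph (Fin n)}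
    (h : ∀ i, adjRow G i = adjRow G' i) : G = G' := by
  ext i j
  have := congrFun (List.ofFn_injective (h i)) j
  simpa using this

theorem encodeNat_injective : Function.Injective Computability.encodeNat :=
  Computability.encodingNatBool.encode_injective

/-! ### Connected `k`-Vertex Cover -/

/-- An instance: a graph and an integer `k`. -/
structure ConnectedVCInstance where
  G : FinGraph
  k : ℕ

namespace ConnectedVCInstance

/-- `G` has a vertex cover of size at most `k` which induces a connected subgraph. -/
def Yes (x : ConnectedVCInstance) : Prop :=
  ∃ S : Finset (Fin x.G.n), S.card ≤ x.k ∧ x.G.graph.IsVertexCover (S : Set (Fin x.G.n)) ∧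
    (x.G.graph.induce (S : Set (Fin x.G.n))).Connected

/-- The number `k` in binary, then the rows of the adjacency matrix. -/
noncomputable def encode (x : ConnectedVCInstance) : List (Option Bool) :=
  encodeBlocks (Computability.encodeNat x.k :: List.ofFn fun i => adjRow x.G.graph i)

theorem encode_injective : Function.Injective encode := by
  rintro ⟨⟨n, G⟩, k⟩ ⟨⟨n', G'⟩, k'⟩ h
  have h := encodeBlocks_injective h
  simp only [List.cons.injEq] at h
  obtain ⟨hk, hrows⟩ := h
  have hn : n = n' := by simpa using congrArg List.length hrows
  subst hn
  have hG : G = G' := adjRow_injective fun i => congrFun (List.ofFn_injective hrows) i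
  rw [encodeNat_injective hk, hG]

end ConnectedVCInstance

/-- Connected `k`-Vertex Cover, parameterized by `k`. -/
noncomputable def connectedVertexCover : GraphProblem where
  Inst := ConnectedVCInstance
  graph x := x.G
  param x := x.k
  encode := ConnectedVCInstance.encode
  encode_injective := ConnectedVCInstance.encode_injective
  Yes := ConnectedVCInstance.Yes

/-! ### Capacitated `k`-Vertex Cover -/

/-- `S` is a capacitated vertex cover of `G` for the capacities `c`: a vertex cover such that every
edge can be assigned to one of its endpoints in `S`, in such a way that no vertex `v ∈ S` is
assigned more than `c v` edges. -/
def IsCapacitatedVertexCover {n : ℕ} (G : SimpleGraph (Fin n)) (c : Fin n → ℕ)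
    (S : Finset (Fin n)) : Prop :=
  G.IsVertexCover (S : Set (Fin n)) ∧
    ∃ ρ : G.edgeSet → Fin n, (∀ e, ρ e ∈ S ∧ ρ e ∈ (e : Sym2 (Fin n))) ∧
      ∀ v ∈ S, {e | ρ e = v}.ncard ≤ c v

/-- An instance: a graph with a capacity function and an integer `k`. -/
structure CapacitatedVCInstance where
  G : FinGraph
  c : Fin G.n → ℕ
  k : ℕ

namespace CapacitatedVCInstance

/-- `G` has a capacitated vertex cover of size at most `k`. -/
def Yes (x : CapacitatedVCInstance) : Prop :=
  ∃ S : Finset (Fin x.G.n), S.card ≤ x.k ∧ IsCapacitatedVertexCover x.G.graph x.c S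

/-- The number `k` in binary, then, for each vertex, its capacity in binary followed by its row of
the adjacency matrix. -/
noncomputable def encode (x : CapacitatedVCInstance) : List (Option Bool) :=
  encodeBlocks (Computability.encodeNat x.k ::
    (List.finRange x.G.n).flatMap fun i =>
      [Computability.encodeNat (x.c i), adjRow x.G.graph i])

theorem encode_injective : Function.Injective encode := by
  have key : ∀ (α : Type) (l : List α) (f g f' g' : α → List Bool),
      (l.flatMap fun i => [f i, g i]) = (l.flatMap fun i => [f' i, g' i]) →
      ∀ i ∈ l, f i = f' i ∧ g i = g' i := by
    intro α l f g f' g' h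
    induction l with
    | nil => simp
    | cons a l ih =>
      simp only [List.flatMap_cons, List.cons_append, List.nil_append, List.cons.injEq] at h
      intro i hi
      rcases List.mem_cons.1 hi with rfl | hi
      · exact ⟨h.1, h.2.1⟩
      · exact ih h.2.2 i hi
  rintro ⟨⟨n, G⟩, c, k⟩ ⟨⟨n', G'⟩, c', k'⟩ h
  have h := encodeBlocks_injective h
  simp only [List.cons.injEq] at h
  obtain ⟨hk, hrows⟩ := h
  have hn : n = n' := by
    have := congrArg List.length hrows
    simpa [List.length_flatMap] using this
  subst hn
  have h' := key _ _ _ _ _ _ hrows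
  have hG : G = G' := adjRow_injective fun i => (h' i (List.mem_finRange i)).2
  have hc : c = c' := funext fun i => encodeNat_injective (h' i (List.mem_finRange i)).1
  subst hG hc
  rw [encodeNat_injective hk]

end CapacitatedVCInstance

/-- Capacitated `k`-Vertex Cover, parameterized by `k`. -/
noncomputable def capacitatedVertexCover : GraphProblem where
  Inst := CapacitatedVCInstance
  graph x := x.G
  param x := x.k
  encode := CapacitatedVCInstance.encode
  encode_injective := CapacitatedVCInstance.encode_injective
  Yes := CapacitatedVCInstance.Yes

/-!
# Quadratic kernels for vertex cover problems on classes of bounded twin-width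

Both kernels come from one reduction rule. In each class of false twins (vertices with the same open
neighborhood) only the `k + 1` vertices of largest capacity are kept; for Connected Vertex Cover all
capacities are taken to be `0`, so that the order of the vertices decides.

*Equivalence.* A set of at most `k` vertices misses one of the kept twins of a removed vertex. Since
exchanging two false twins is an automorphism, a solution can be moved off the removed vertices one
vertex at a time, and for the capacitated problem the exchange is towards a larger capacity
(`SimpleGraph.exists_disjoint_removed`). Conversely, a small vertex cover of the kept vertices misses
a kept twin of each removed vertex, hence contains the whole neighborhood of the removed vertex
(`SimpleGraph.isVertexCover_of_kept`). A capacitated cover without removed vertices has to cover all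
edges to removed vertices from their other ends, so each kept vertex pays for its removed neighbors
in advance, and the instance is rejected if some capacity becomes negative
(`SimpleGraph.capacitatedCover_kept_iff`). Capacities are truncated to the number of kept vertices,
which bounds the size of the output.

*Size.* Let `S` be a vertex cover with at most `k` vertices. The neighborhood of a vertex outside `S`
is a subset of `S`, so it suffices to bound the number of traces of neighborhoods on `S` linearly in
`|S|` (`FinGraph.TwinWidthLE.card_traces_le`). In a contraction sequence, consider the first trigraph
in which two vertices `x` and `x'` of `S` lie in the same part. A part contains at most two vertices
of `S`. A trace which distinguishes `x` from `x'` comes from one of the at most `d + 1` parts which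
are equal to the part of `x` or joined to it by a red edge, and the traces coming from such a part
differ only in at most `d + 1` parts, hence on at most `2 (d + 1)` vertices of `S`. So a bounded number
of traces distinguishes `x` from `x'`, and removing `x` from `S` loses at most that many traces.
Consequently an instance with too many kept vertices is a no-instance, and is rejected.

*Running time.* The contraction sequence is not needed to compute the kernel: the rule only counts
and compares. A small imperative language on stacks (`Cmd`, `Exec`) is compiled to Turing machines.
On top of it, the functions of a context (the input word and some unary variables) that are computed
in polynomial time by this language (`PolyNat`, `PolyPred`, `PolyWord`) are closed under bounded sums
and under concatenations over a bounded range. Bounded sums give counting, bounded quantifiers and all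
the arithmetic that is needed, including the conversion between unary and binary numbers. Numbers of
the input may be exponentially large, and are truncated while they are read
(`PolyNat.min_blockValue`): neither the parameter nor the capacities matter beyond the number of
vertices.
-/

/-! ### A structured language for stack machines -/

/-- The stacks of the machine: `inp` holds the input word, `env` the values of the variables in
scope, `val` the intermediate results, `out` the output word; `aux` and `tmp` are scratch space. -/
inductive Stk
  | inp | aux | env | val | tmp | out
  deriving DecidableEq

instance : Fintype Stk :=
  ⟨{.inp, .aux, .env, .val, .tmp, .out}, by rintro ⟨⟩ <;> decide⟩

/-- The contents of all stacks, the top of a stack being the head of the list. -/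
structure Mem where
  inp : List (Option Bool)
  aux : List (Option Bool)
  env : List (Option Bool)
  val : List (Option Bool)
  tmp : List (Option Bool)
  out : List (Option Bool)

namespace Mem

/-- The content of the stack `k`. -/
def get (s : Mem) : Stk → List (Option Bool)
  | .inp => s.inp
  | .aux => s.aux
  | .env => s.env
  | .val => s.val
  | .tmp => s.tmp
  | .out => s.out

/-- Replace the content of the stack `k`. -/
def set (s : Mem) : Stk → List (Option Bool) → Mem
  | .inp, l => { s with inp := l }
  | .aux, l => { s with aux := l }
  | .env, l => { s with env := l }
  | .val, l => { s with val := l }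
  | .tmp, l => { s with tmp := l }
  | .out, l => { s with out := l }

attribute [simp] get.eq_1 get.eq_2 get.eq_3 get.eq_4 get.eq_5 get.eq_6
  set.eq_1 set.eq_2 set.eq_3 set.eq_4 set.eq_5 set.eq_6

theorem get_set (s : Mem) (k : Stk) (l : List (Option Bool)) :
    (s.set k l).get = Function.update s.get k l := by
  funext j
  cases k <;> cases j <;> rfl

end Mem

/-- Structured programs on the stacks. The tests of `cond` and `loop` look at the top symbol of a
stack (`none` if the stack is empty). -/
inductive Cmd
  | skip
  | push (k : Stk) (a : Option Bool)
  | pop (k : Stk)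
  | move (j k : Stk)
  | seq (p q : Cmd)
  | cond (k : Stk) (t : Option (Option Bool) → Bool) (p q : Cmd)
  | loop (k : Stk) (t : Option (Option Bool) → Bool) (p : Cmd)

/-- `Exec p s s' n`: started with the stacks `s`, the program `p` ends with the stacks `s'` after
at most `n` steps. -/
inductive Exec : Cmd → Mem → Mem → ℕ → Prop
  | skip (s : Mem) : Exec .skip s s 1
  | push (s : Mem) (k : Stk) (a : Option Bool) : Exec (.push k a) s (s.set k (a :: s.get k)) 1
  | pop (s : Mem) (k : Stk) : Exec (.pop k) s (s.set k (s.get k).tail) 1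
  | move (s : Mem) (j k : Stk) (a : Option Bool) (l : List (Option Bool)) (h : s.get j = a :: l) :
      Exec (.move j k) s ((s.set j l).set k (a :: (s.set j l).get k)) 1
  | seq {p q : Cmd} {s s₁ s₂ : Mem} {n m : ℕ} (hp : Exec p s s₁ n) (hq : Exec q s₁ s₂ m) :
      Exec (.seq p q) s s₂ (n + m)
  | cond_true {k : Stk} {t : Option (Option Bool) → Bool} {p q : Cmd} {s s' : Mem} {n : ℕ}
      (h : t (s.get k).head? = true) (hp : Exec p s s' n) : Exec (.cond k t p q) s s' (n + 1)
  | cond_false {k : Stk} {t : Option (Option Bool) → Bool} {p q : Cmd} {s s' : Mem} {n : ℕ}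
      (h : t (s.get k).head? = false) (hq : Exec q s s' n) : Exec (.cond k t p q) s s' (n + 1)
  | loop_true {k : Stk} {t : Option (Option Bool) → Bool} {p : Cmd} {s s₁ s₂ : Mem} {n m : ℕ}
      (h : t (s.get k).head? = true) (hp : Exec p s s₁ n) (hl : Exec (.loop k t p) s₁ s₂ m) :
      Exec (.loop k t p) s s₂ (n + m + 1)
  | loop_false {k : Stk} {t : Option (Option Bool) → Bool} {p : Cmd} {s : Mem}
      (h : t (s.get k).head? = false) : Exec (.loop k t p) s s 1
  | mono {p : Cmd} {s s' : Mem} {n m : ℕ} (h : Exec p s s' n) (hnm : n ≤ m) : Exec p s s' m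

/-! ### Compilation to multi-stack Turing machines -/

namespace Cmd

/-- The labels of the compiled program. -/
def Label : Cmd → Type
  | skip | push _ _ | pop _ | move _ _ => Unit
  | seq p q => p.Label ⊕ q.Label
  | cond _ _ p q => Option (p.Label ⊕ q.Label)
  | loop _ _ p => Option p.Label

/-- There are finitely many labels. -/
@[reducible] def labelFintype : (p : Cmd) → Fintype p.Label
  | skip | push _ _ | pop _ | move _ _ => inferInstanceAs (Fintype Unit)
  | seq p q =>
    letI := p.labelFintype
    letI := q.labelFintype
    inferInstanceAs (Fintype (p.Label ⊕ q.Label))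
  | cond _ _ p q =>
    letI := p.labelFintype
    letI := q.labelFintype
    inferInstanceAs (Fintype (Option (p.Label ⊕ q.Label)))
  | loop _ _ p =>
    letI := p.labelFintype
    inferInstanceAs (Fintype (Option p.Label))

/-- The label at which the compiled program starts. -/
def entry : (p : Cmd) → p.Label
  | skip | push _ _ | pop _ | move _ _ => ()
  | seq p _ => Sum.inl p.entry
  | cond _ _ _ _ | loop _ _ _ => none

/-- The statements of the compiled program, inside a machine with label type `Λ`: `e` embeds the
labels of the program, and the program jumps to `x` when it ends. The internal state of the machine
stores the symbol that was last read; it is reset to `none` before each jump. -/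
def code {Λ : Type} : (p : Cmd) → (e : p.Label → Λ) → (x : Λ) → p.Label →
    Turing.TM2.Stmt (fun _ : Stk => Option Bool) Λ (Option (Option Bool))
  | skip, _, x, _ => .goto fun _ => x
  | push k a, _, x, _ => .push k (fun _ => a) (.goto fun _ => x)
  | pop k, _, x, _ => .pop k (fun v _ => v) (.goto fun _ => x)
  | move j k, _, x, _ =>
    .pop j (fun _ o => o) (.push k (fun v => v.getD none) (.load (fun _ => none) (.goto fun _ => x)))
  | seq p _, e, _, Sum.inl l => p.code (fun l => e (Sum.inl l)) (e (Sum.inr (entry _))) l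
  | seq _ q, e, x, Sum.inr l => q.code (fun l => e (Sum.inr l)) x l
  | cond k t p q, e, _, none =>
    .peek k (fun _ o => o) (.branch t
      (.load (fun _ => none) (.goto fun _ => e (some (Sum.inl p.entry))))
      (.load (fun _ => none) (.goto fun _ => e (some (Sum.inr q.entry)))))
  | cond _ _ p _, e, x, some (Sum.inl l) => p.code (fun l => e (some (Sum.inl l))) x l
  | cond _ _ _ q, e, x, some (Sum.inr l) => q.code (fun l => e (some (Sum.inr l))) x l
  | loop k t p, e, x, none =>
    .peek k (fun _ o => o) (.branch t
      (.load (fun _ => none) (.goto fun _ => e (some p.entry)))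
      (.load (fun _ => none) (.goto fun _ => x)))
  | loop _ _ p, e, _, some l => p.code (fun l => e (some l)) (e none) l

end Cmd

/-- The machine `M` reaches the configuration `c'` from `c` in exactly `n` steps. -/
def Steps {Λ : Type} (M : Λ → Turing.TM2.Stmt (fun _ : Stk => Option Bool) Λ (Option (Option Bool)))
    (n : ℕ) (c c' : Turing.TM2.Cfg (fun _ : Stk => Option Bool) Λ (Option (Option Bool))) : Prop :=
  (flip bind (Turing.TM2.step M))^[n] (some c) = some c'

namespace Steps

variable {Λ : Type} {M : Λ → Turing.TM2.Stmt (fun _ : Stk => Option Bool) Λ (Option (Option Bool))}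
  {c₁ c₂ c₃ : Turing.TM2.Cfg (fun _ : Stk => Option Bool) Λ (Option (Option Bool))} {n m : ℕ}

theorem one (h : Turing.TM2.step M c₁ = some c₂) : Steps M 1 c₁ c₂ := h

theorem trans (h : Steps M n c₁ c₂) (h' : Steps M m c₂ c₃) : Steps M (n + m) c₁ c₃ := by
  unfold Steps at *
  rw [Nat.add_comm, Function.iterate_add_apply, h, h']

end Steps

/-- The compiled program behaves as the structured program, in any machine containing it. -/
theorem Exec.steps {Λ : Type}
    {M : Λ → Turing.TM2.Stmt (fun _ : Stk => Option Bool) Λ (Option (Option Bool))}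
    {p : Cmd} {s s' : Mem} {n : ℕ} (h : Exec p s s' n) :
    ∀ (e : p.Label → Λ) (x : Λ), (∀ l, M (e l) = p.code e x l) →
      ∃ m ≤ n, Steps M m ⟨some (e p.entry), none, s.get⟩ ⟨some x, none, s'.get⟩ := by
  induction h with
  | skip s =>
    intro e x hM
    refine ⟨1, le_rfl, Steps.one ?_⟩
    simp [hM, Cmd.code]
  | push s k a =>
    intro e x hM
    refine ⟨1, le_rfl, Steps.one ?_⟩
    simp [hM, Cmd.code, Mem.get_set]
  | pop s k =>
    intro e x hM
    refine ⟨1, le_rfl, Steps.one ?_⟩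
    simp [hM, Cmd.code, Mem.get_set]
  | move s j k a l h =>
    intro e x hM
    refine ⟨1, le_rfl, Steps.one ?_⟩
    simp [hM, Cmd.code, Mem.get_set, h]
  | @seq p q s s₁ s₂ n m _ _ ihp ihq =>
    intro e x hM
    obtain ⟨a, ha, h₁⟩ := ihp (fun l => e (Sum.inl l)) (e (Sum.inr q.entry))
      fun l => hM (Sum.inl l)
    obtain ⟨b, hb, h₂⟩ := ihq (fun l => e (Sum.inr l)) x fun l => hM (Sum.inr l)
    exact ⟨a + b, by omega, h₁.trans h₂⟩
  | @cond_true k t p q s s' n h _ ih =>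
    intro e x hM
    obtain ⟨a, ha, h₁⟩ := ih (fun l => e (some (Sum.inl l))) x fun l => hM (some (Sum.inl l))
    refine ⟨1 + a, by omega, (Steps.one ?_).trans h₁⟩
    change some (Turing.TM2.stepAux (M (e none)) _ _) = _
    rw [hM none]
    simp [Cmd.code, h]
  | @cond_false k t p q s s' n h _ ih =>
    intro e x hM
    obtain ⟨a, ha, h₁⟩ := ih (fun l => e (some (Sum.inr l))) x fun l => hM (some (Sum.inr l))
    refine ⟨1 + a, by omega, (Steps.one ?_).trans h₁⟩
    change some (Turing.TM2.stepAux (M (e none)) _ _) = _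
    rw [hM none]
    simp [Cmd.code, h]
  | @loop_true k t p s s₁ s₂ n m h _ _ ihp ihl =>
    intro e x hM
    obtain ⟨a, ha, h₁⟩ := ihp (fun l => e (some l)) (e none) fun l => hM (some l)
    obtain ⟨b, hb, h₂⟩ := ihl e x hM
    refine ⟨1 + (a + b), by omega, (Steps.one ?_).trans (h₁.trans h₂)⟩
    change some (Turing.TM2.stepAux (M (e none)) _ _) = _
    rw [hM none]
    simp [Cmd.code, h]
  | @loop_false k t p s h =>
    intro e x hM
    refine ⟨1, le_rfl, Steps.one ?_⟩
    change some (Turing.TM2.stepAux (M (e none)) _ _) = _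
    rw [hM none]
    simp [Cmd.code, h]
  | mono _ hnm ih =>
    intro e x hM
    obtain ⟨a, ha, h₁⟩ := ih e x hM
    exact ⟨a, ha.trans hnm, h₁⟩

/-- The machine that runs the program `p` and halts. -/
def Cmd.machine (p : Cmd) : Turing.FinTM2 where
  K := Stk
  k₀ := .inp
  k₁ := .out
  Γ _ := Option Bool
  Λ := Option p.Label
  main := some p.entry
  ΛFin := letI := p.labelFintype; inferInstance
  σ := Option (Option Bool)
  initialState := none
  m
    | none => .halt
    | some l => p.code some none l

/-- The alphabet of the machine is the alphabet of the encodings, so that no recoding is needed. -/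
theorem nonempty_tm2ComputableInPolyTime_of_exec {α : Type} {ea : α → List (Option Bool)}
    {eb : α → List (Option Bool)} {f : α → α} (p : Cmd) (T : Polynomial ℕ)
    (h : ∀ a, Exec p ⟨ea a, [], [], [], [], []⟩ ⟨[], [], [], [], [], eb (f a)⟩
      (T.eval (ea a).length)) :
    Nonempty (Turing.TM2ComputableInPolyTime ea eb f) := by
  have key : ∀ a, ∃ m ≤ (T + 1).eval (ea a).length,
      Steps p.machine.m m ⟨some (some p.entry), none, Mem.get ⟨ea a, [], [], [], [], []⟩⟩
        ⟨none, none, Mem.get ⟨[], [], [], [], [], eb (f a)⟩⟩ := by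
    intro a
    obtain ⟨m, hm, hs⟩ := (h a).steps (M := p.machine.m) some none fun l => rfl
    refine ⟨m + 1, by simpa using hm, hs.trans (Steps.one rfl)⟩
  choose m hm hs using key
  refine ⟨⟨⟨p.machine, Equiv.refl _, Equiv.refl _⟩, T + 1, fun a => ⟨⟨m a, ?_⟩, hm a⟩⟩⟩
  have hinit : Turing.initList p.machine (List.map id (ea a)) =
      ⟨some (some p.entry), none, Mem.get ⟨ea a, [], [], [], [], []⟩⟩ := by
    refine congrArg (Turing.TM2.Cfg.mk _ _) ?_
    funext k
    cases k <;> simp [Cmd.machine] <;> rfl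
  have hhalt : Turing.haltList p.machine (List.map id (eb (f a))) =
      ⟨none, none, Mem.get ⟨[], [], [], [], [], eb (f a)⟩⟩ := by
    refine congrArg (Turing.TM2.Cfg.mk _ _) ?_
    funext k
    cases k <;> simp [Cmd.machine] <;> rfl
  refine Eq.trans ?_ (Eq.trans (hs a) (congrArg some hhalt.symm))
  exact congrArg (fun c => (flip bind p.machine.step)^[m a] (some c)) hinit

/-! ### Functions computed in polynomial time -/

theorem Mem.ext_get {s s' : Mem} (h : ∀ k, s.get k = s'.get k) : s = s' := by
  obtain ⟨a, b, c, d, e, f⟩ := s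
  obtain ⟨a', b', c', d', e', f'⟩ := s'
  have h₁ : a = a' := h .inp
  have h₂ : b = b' := h .aux
  have h₃ : c = c' := h .env
  have h₄ : d = d' := h .val
  have h₅ : e = e' := h .tmp
  have h₆ : f = f' := h .out
  rw [h₁, h₂, h₃, h₄, h₅, h₆]

/-- Is the top symbol a mark, that is, a unit of a unary number? -/
def isMark (o : Option (Option Bool)) : Bool := o == some (some true)

/-- Is the top symbol a bit? -/
def isBit : Option (Option Bool) → Bool
  | some (some _) => true
  | _ => false

/-- The number `n` in unary, followed by a separator. -/
def blk (n : ℕ) : List (Option Bool) := List.replicate n (some true) ++ [none]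

@[simp] theorem length_blk (n : ℕ) : (blk n).length = n + 1 := by simp [blk]

theorem blk_append (n : ℕ) (l : List (Option Bool)) :
    blk n ++ l = List.replicate n (some true) ++ none :: l := by simp [blk]

/-- Moving symbols one by one reverses their order. -/
theorem Exec.loop_move {j k : Stk} (hjk : j ≠ k) {t : Option (Option Bool) → Bool}
    {r : List (Option Bool)} (hr : t r.head? = false) :
    ∀ {l : List (Option Bool)} {s : Mem}, s.get j = l ++ r → (∀ a ∈ l, t (some a) = true) →
      Exec (.loop j t (.move j k)) s ((s.set j r).set k (l.reverse ++ s.get k))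
        (2 * l.length + 1) := by
  intro l
  induction l with
  | nil =>
    intro s hs _
    have h : (s.set j r).set k ([].reverse ++ s.get k) = s := by
      refine Mem.ext_get fun i => ?_
      simp only [Mem.get_set, Function.update_apply]
      split_ifs <;> simp_all
    rw [h]
    exact Exec.loop_false (by simpa [hs] using hr)
  | cons a l ih =>
    intro s hs hl
    have h := ih (s := (s.set j (l ++ r)).set k (a :: (s.set j (l ++ r)).get k))
      (by simp [Mem.get_set, Function.update_of_ne hjk]) fun b hb => hl b (List.mem_cons_of_mem _ hb)
    refine (Exec.loop_true (m := 2 * l.length + 1) (by simpa [hs] using hl a List.mem_cons_self)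
      (Exec.move s j k a (l ++ r) hs) ?_).mono (by simp; omega)
    · convert h using 1
      refine Mem.ext_get fun i => ?_
      simp only [Mem.get_set, Function.update_apply]
      split_ifs <;> simp_all

theorem Exec.loop_move_marks {j k : Stk} (hjk : j ≠ k) {n : ℕ} {r : List (Option Bool)}
    (hr : isMark r.head? = false) {s : Mem} (hs : s.get j = List.replicate n (some true) ++ r) :
    Exec (.loop j isMark (.move j k)) s
      ((s.set j r).set k (List.replicate n (some true) ++ s.get k)) (2 * n + 1) := by
  have h := Exec.loop_move hjk hr hs (by simp [isMark])
  simpa using h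

/-- A type of contexts: each context consists of the input word, given as a list of blocks, and of
the contents of the stack of variables. -/
class Ctx (X : Type) where
  word : X → List (List Bool)
  env : X → List (Option Bool)

/-- A context is extended by a new variable, which is pushed in unary. -/
instance {X : Type} [Ctx X] : Ctx (X × ℕ) where
  word x := Ctx.word x.1
  env x := blk x.2 ++ Ctx.env x.1

section

variable {X : Type} [Ctx X]

/-- The size of a context. -/
def Ctx.size (x : X) : ℕ := (encodeBlocks (Ctx.word x)).length + (Ctx.env x).length

/-- The stacks in the context `x`, with intermediate results `v` and output `o`. -/
def Ctx.mem (x : X) (v o : List (Option Bool)) : Mem :=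
  ⟨encodeBlocks (Ctx.word x), [], Ctx.env x, v, [], o⟩

theorem Ctx.size_pair (x : X) (i : ℕ) : Ctx.size (x, i) = Ctx.size x + (i + 1) := by
  simp only [Ctx.size, Ctx.word, Ctx.env, List.length_append, length_blk]
  omega

/-- `f` is polynomially bounded and computed in polynomial time: some program pushes the value of
`f` on the stack of intermediate results. -/
def PolyNat (f : X → ℕ) : Prop :=
  ∃ (p : Cmd) (T B : Polynomial ℕ), ∀ x, f x ≤ B.eval (Ctx.size x) ∧
    ∀ v o, Exec p (Ctx.mem x v o) (Ctx.mem x (blk (f x) ++ v) o) (T.eval (Ctx.size x))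

/-- The word-valued function `g` is computed in polynomial time: some program puts the value of `g`
in front of the output. -/
def PolyWord (g : X → List (Option Bool)) : Prop :=
  ∃ (p : Cmd) (T : Polynomial ℕ), ∀ x v o,
    Exec p (Ctx.mem x v o) (Ctx.mem x v (g x ++ o)) (T.eval (Ctx.size x))

end

theorem Polynomial.eval_nat_mono (p : Polynomial ℕ) {m n : ℕ} (h : m ≤ n) :
    p.eval m ≤ p.eval n := by
  induction p using Polynomial.induction_on' with
  | add p q hp hq => simpa using add_le_add hp hq
  | monomial i a => simpa using Nat.mul_le_mul_left a (Nat.pow_le_pow_left h i)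

/-! ### Basic programs -/

/-- Add the two top numbers. -/
def Cmd.add : Cmd :=
  .seq (.loop .val isMark (.move .val .tmp)) (.seq (.pop .val) (.loop .tmp isMark (.move .tmp .val)))

theorem Exec.add (i a e v o : List (Option Bool)) (m n : ℕ) :
    Exec Cmd.add ⟨i, a, e, blk m ++ (blk n ++ v), [], o⟩ ⟨i, a, e, blk (m + n) ++ v, [], o⟩
      (4 * m + 3) := by
  have h₁ : Exec (.loop .val isMark (.move .val .tmp))
      ⟨i, a, e, blk m ++ (blk n ++ v), [], o⟩
      ⟨i, a, e, none :: (blk n ++ v), List.replicate m (some true), o⟩ (2 * m + 1) := by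
    simpa using Exec.loop_move_marks (j := .val) (k := .tmp) (by decide)
      (r := none :: (blk n ++ v)) rfl
      (s := ⟨i, a, e, blk m ++ (blk n ++ v), [], o⟩) (n := m) (by simp [blk])
  have h₂ : Exec (.loop .tmp isMark (.move .tmp .val))
      ⟨i, a, e, blk n ++ v, List.replicate m (some true), o⟩
      ⟨i, a, e, blk (m + n) ++ v, [], o⟩ (2 * m + 1) := by
    rw [show blk (m + n) ++ v = List.replicate m (some true) ++ (blk n ++ v) by
      rw [blk_append, blk_append, List.replicate_add, List.append_assoc]]
    simpa using Exec.loop_move_marks (j := .tmp) (k := .val) (by decide)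
      (r := []) rfl (s := ⟨i, a, e, blk n ++ v, List.replicate m (some true), o⟩) (n := m) (by simp)
  exact (h₁.seq ((Exec.pop _ .val).seq h₂)).mono (by omega)

/-- Subtract the top number from the one below it. -/
def Cmd.sub : Cmd :=
  .seq (.loop .val isMark (.move .val .tmp)) (.seq (.pop .val)
    (.loop .tmp isMark (.seq (.pop .tmp) (.cond .val isMark (.pop .val) .skip))))

theorem Exec.sub (i a e v o : List (Option Bool)) (m n : ℕ) :
    Exec Cmd.sub ⟨i, a, e, blk m ++ (blk n ++ v), [], o⟩ ⟨i, a, e, blk (n - m) ++ v, [], o⟩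
      (6 * m + 3) := by
  have h₁ : Exec (.loop .val isMark (.move .val .tmp))
      ⟨i, a, e, blk m ++ (blk n ++ v), [], o⟩
      ⟨i, a, e, none :: (blk n ++ v), List.replicate m (some true), o⟩ (2 * m + 1) := by
    simpa using Exec.loop_move_marks (j := .val) (k := .tmp) (by decide)
      (r := none :: (blk n ++ v)) rfl
      (s := ⟨i, a, e, blk m ++ (blk n ++ v), [], o⟩) (n := m) (by simp [blk])
  have h₂ : ∀ m n, Exec
      (.loop .tmp isMark (.seq (.pop .tmp) (.cond .val isMark (.pop .val) .skip)))
      ⟨i, a, e, blk n ++ v, List.replicate m (some true), o⟩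
      ⟨i, a, e, blk (n - m) ++ v, [], o⟩ (4 * m + 1) := by
    intro m
    induction m with
    | zero => intro n; exact (Exec.loop_false rfl).mono (by omega)
    | succ m ih =>
      intro n
      have h₃ : Exec (.cond .val isMark (.pop .val) .skip)
          ⟨i, a, e, blk n ++ v, List.replicate m (some true), o⟩
          ⟨i, a, e, blk (n - 1) ++ v, List.replicate m (some true), o⟩ 2 := by
        cases n with
        | zero => exact Exec.cond_false rfl (Exec.skip _)
        | succ n => exact Exec.cond_true rfl (Exec.pop _ .val)
      have h₄ := ih (n - 1)
      rw [Nat.sub_sub, Nat.add_comm 1 m] at h₄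
      exact (Exec.loop_true rfl ((Exec.pop _ .tmp).seq h₃) h₄).mono (by omega)
  exact (h₁.seq ((Exec.pop _ .val).seq (h₂ m n))).mono (by omega)

/-- Run `c` for all values of the top variable below its initial value, in descending order, and
remove the variable. -/
def Cmd.forDown (c : Cmd) : Cmd :=
  .seq (.loop .env isMark (.seq (.pop .env) c)) (.pop .env)

theorem Exec.forDown {X : Type} [Ctx X] {x : X} {c : Cmd} {t : ℕ} (V O : ℕ → List (Option Bool)) :
    ∀ n : ℕ, (∀ i < n, Exec c (Ctx.mem (x, i) (V (i + 1)) (O (i + 1)))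
      (Ctx.mem (x, i) (V i) (O i)) t) →
    Exec (.forDown c) (Ctx.mem (x, n) (V n) (O n)) (Ctx.mem x (V 0) (O 0)) (n * (t + 2) + 2) := by
  have key : ∀ n : ℕ, (∀ i < n, Exec c (Ctx.mem (x, i) (V (i + 1)) (O (i + 1)))
      (Ctx.mem (x, i) (V i) (O i)) t) →
      Exec (.loop .env isMark (.seq (.pop .env) c)) (Ctx.mem (x, n) (V n) (O n))
        (Ctx.mem (x, 0) (V 0) (O 0)) (n * (t + 2) + 1) := by
    intro n
    induction n with
    | zero => intro _; exact (Exec.loop_false rfl).mono (by omega)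
    | succ n ih =>
      intro h
      have h₁ := ih fun i hi => h i (by omega)
      have h₂ := h n (by omega)
      refine (Exec.loop_true rfl ((Exec.pop _ .env).seq h₂) h₁).mono ?_
      rw [Nat.add_mul]
      omega
  intro n h
  exact (key n h).seq (Exec.pop _ .env)

/-- Turn the top number into a new variable, leaving a zero. -/
def Cmd.bind : Cmd := .seq (.push .env none) (.loop .val isMark (.move .val .env))

theorem Exec.bind {X : Type} [Ctx X] (x : X) (n : ℕ) (v o : List (Option Bool)) :
    Exec Cmd.bind (Ctx.mem x (blk n ++ v) o) (Ctx.mem (x, n) (blk 0 ++ v) o) (2 * n + 2) := by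
  have h : Exec (.loop .val isMark (.move .val .env))
      ⟨encodeBlocks (Ctx.word x), [], none :: Ctx.env x, blk n ++ v, [], o⟩
      (Ctx.mem (x, n) (blk 0 ++ v) o) (2 * n + 1) := by
    simpa [Ctx.mem, Ctx.env, Ctx.word, blk] using
      Exec.loop_move_marks (j := .val) (k := .env) (by decide) (r := none :: v) rfl
      (s := ⟨encodeBlocks (Ctx.word x), [], none :: Ctx.env x, blk n ++ v, [], o⟩) (n := n)
      (by simp [blk])
  exact ((Exec.push _ .env none).seq h).mono (by omega)

/-- Hide the top variable below the intermediate results. -/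
def Cmd.hide : Cmd :=
  .seq (.push .val none) (.seq (.loop .env isMark (.move .env .val)) (.pop .env))

theorem Exec.hide {X : Type} [Ctx X] (x : X) (n : ℕ) (v o : List (Option Bool)) :
    Exec Cmd.hide (Ctx.mem (x, n) v o) (Ctx.mem x (blk n ++ v) o) (2 * n + 3) := by
  have h : Exec (.loop .env isMark (.move .env .val))
      ⟨encodeBlocks (Ctx.word x), [], blk n ++ Ctx.env x, none :: v, [], o⟩
      ⟨encodeBlocks (Ctx.word x), [], none :: Ctx.env x, blk n ++ v, [], o⟩ (2 * n + 1) := by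
    simpa [blk] using
      Exec.loop_move_marks (j := .env) (k := .val) (by decide) (r := none :: Ctx.env x) rfl
      (s := ⟨encodeBlocks (Ctx.word x), [], blk n ++ Ctx.env x, none :: v, [], o⟩) (n := n)
      (by simp [blk])
  exact ((Exec.push _ .val none).seq (h.seq (Exec.pop _ .env))).mono (by omega)

/-- Restore a hidden variable. -/
def Cmd.unhide : Cmd := .seq .bind (.pop .val)

theorem Exec.unhide {X : Type} [Ctx X] (x : X) (n : ℕ) (v o : List (Option Bool)) :
    Exec Cmd.unhide (Ctx.mem x (blk n ++ v) o) (Ctx.mem (x, n) v o) (2 * n + 3) :=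
  (Exec.bind x n v o).seq (Exec.pop _ .val)

/-- Restore a variable which is hidden below the top number. -/
def Cmd.unhideBelow : Cmd :=
  .seq (.loop .val isMark (.move .val .tmp)) (.seq (.pop .val) (.seq (.push .env none)
    (.seq (.loop .val isMark (.move .val .env)) (.loop .tmp isMark (.move .tmp .val)))))

theorem Exec.unhideBelow {X : Type} [Ctx X] (x : X) (m n : ℕ) (v o : List (Option Bool)) :
    Exec Cmd.unhideBelow (Ctx.mem x (blk m ++ (blk n ++ v)) o) (Ctx.mem (x, n) (blk m ++ v) o)
      (4 * m + 2 * n + 5) := by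
  have h₁ : Exec (.loop .val isMark (.move .val .tmp))
      (Ctx.mem x (blk m ++ (blk n ++ v)) o)
      ⟨encodeBlocks (Ctx.word x), [], Ctx.env x, none :: (blk n ++ v),
        List.replicate m (some true), o⟩ (2 * m + 1) := by
    simpa [Ctx.mem] using Exec.loop_move_marks (j := .val) (k := .tmp) (by decide)
      (r := none :: (blk n ++ v)) rfl
      (s := (Ctx.mem x (blk m ++ (blk n ++ v)) o)) (n := m) (by simp [blk, Ctx.mem])
  have h₂ : Exec (.loop .val isMark (.move .val .env))
      ⟨encodeBlocks (Ctx.word x), [], none :: Ctx.env x, blk n ++ v,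
        List.replicate m (some true), o⟩
      ⟨encodeBlocks (Ctx.word x), [], blk n ++ Ctx.env x, none :: v,
        List.replicate m (some true), o⟩ (2 * n + 1) := by
    simpa [blk] using
      Exec.loop_move_marks (j := .val) (k := .env) (by decide) (r := none :: v) rfl
      (s := ⟨encodeBlocks (Ctx.word x), [], none :: Ctx.env x, blk n ++ v,
        List.replicate m (some true), o⟩) (n := n) (by simp [blk])
  have h₃ : Exec (.loop .tmp isMark (.move .tmp .val))
      ⟨encodeBlocks (Ctx.word x), [], blk n ++ Ctx.env x, none :: v,
        List.replicate m (some true), o⟩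
      (Ctx.mem (x, n) (blk m ++ v) o) (2 * m + 1) := by
    simpa [blk, Ctx.mem, Ctx.word, Ctx.env] using
      Exec.loop_move_marks (j := .tmp) (k := .val) (by decide)
      (r := []) rfl (s := ⟨encodeBlocks (Ctx.word x), [], blk n ++ Ctx.env x, none :: v,
        List.replicate m (some true), o⟩) (n := m) (by simp)
  exact (h₁.seq ((Exec.pop _ .val).seq ((Exec.push _ .env none).seq (h₂.seq h₃)))).mono (by omega)

/-- Push the value of the top variable. -/
def Cmd.var : Cmd :=
  .seq (.push .val none) (.seq (.loop .env isMark (.move .env .tmp))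
    (.loop .tmp isMark (.seq (.push .val (some true)) (.move .tmp .env))))

theorem Exec.var {X : Type} [Ctx X] (x : X) (n : ℕ) (v o : List (Option Bool)) :
    Exec Cmd.var (Ctx.mem (x, n) v o) (Ctx.mem (x, n) (blk n ++ v) o) (5 * n + 3) := by
  have h₁ : Exec (.loop .env isMark (.move .env .tmp))
      ⟨encodeBlocks (Ctx.word x), [], blk n ++ Ctx.env x, none :: v, [], o⟩
      ⟨encodeBlocks (Ctx.word x), [], none :: Ctx.env x, none :: v,
        List.replicate n (some true), o⟩ (2 * n + 1) := by
    simpa [blk] using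
      Exec.loop_move_marks (j := .env) (k := .tmp) (by decide) (r := none :: Ctx.env x) rfl
      (s := ⟨encodeBlocks (Ctx.word x), [], blk n ++ Ctx.env x, none :: v, [], o⟩) (n := n)
      (by simp [blk])
  have h₂ : ∀ m e w, Exec (.loop .tmp isMark (.seq (.push .val (some true)) (.move .tmp .env)))
      ⟨encodeBlocks (Ctx.word x), [], e, w, List.replicate m (some true), o⟩
      ⟨encodeBlocks (Ctx.word x), [], List.replicate m (some true) ++ e,
        List.replicate m (some true) ++ w, [], o⟩ (3 * m + 1) := by
    intro m
    induction m with
    | zero => intro e w; exact (Exec.loop_false rfl).mono (by omega)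
    | succ m ih =>
      intro e w
      have h₃ := ih (some true :: e) (some true :: w)
      rw [List.append_cons _ _ e, List.append_cons _ _ w, ← List.replicate_succ'] at h₃
      exact (Exec.loop_true rfl ((Exec.push _ .val (some true)).seq
        (Exec.move _ .tmp .env (some true) (List.replicate m (some true)) rfl)) h₃).mono (by omega)
  have h₄ := h₂ n (none :: Ctx.env x) (none :: v)
  rw [← blk_append, ← blk_append] at h₄
  exact ((Exec.push _ .val none).seq (h₁.seq h₄)).mono (by omega)

/-! ### Closure properties -/

section

variable {X : Type} [Ctx X]

theorem PolyNat.zero : PolyNat fun _ : X => 0 :=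
  ⟨.push .val none, 1, 0, fun x => ⟨by simp, fun v o =>
    (Exec.push (Ctx.mem x v o) .val none).mono (by simp)⟩⟩

theorem PolyNat.succ {f : X → ℕ} (hf : PolyNat f) : PolyNat fun x => f x + 1 := by
  obtain ⟨p, T, B, h⟩ := hf
  refine ⟨.seq p (.push .val (some true)), T + 1, B + 1, fun x => ⟨by simpa using (h x).1,
    fun v o => ?_⟩⟩
  exact (((h x).2 v o).seq (Exec.push _ .val (some true))).mono (by simp)

theorem PolyNat.const (n : ℕ) : PolyNat fun _ : X => n := by
  induction n with
  | zero => exact PolyNat.zero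
  | succ n ih => exact ih.succ

theorem PolyNat.var : PolyNat fun x : X × ℕ => x.2 := by
  refine ⟨.var, 5 * Polynomial.X + 3, Polynomial.X, fun x => ?_⟩
  have hx : x.2 ≤ Ctx.size x := by rw [← Prod.mk.eta (p := x), Ctx.size_pair]; simp; omega
  refine ⟨by simpa using hx, fun v o => (Exec.var x.1 x.2 v o).mono ?_⟩
  simp only [Polynomial.eval_add, Polynomial.eval_mul, Polynomial.eval_X, Polynomial.eval_ofNat]
  omega

/-- A function of a context may be used in an extension of the context: its program is run while the
new variable is kept below the intermediate results. -/
theorem PolyNat.weaken {f : X → ℕ} (hf : PolyNat f) : PolyNat fun x : X × ℕ => f x.1 := by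
  obtain ⟨p, T, B, h⟩ := hf
  refine ⟨.seq .hide (.seq p .unhideBelow), T + 4 * B + 4 * Polynomial.X + 8, B, ?_⟩
  rintro ⟨x, n⟩
  have hx : Ctx.size x ≤ Ctx.size (x, n) := by rw [Ctx.size_pair]; omega
  have hn : n ≤ Ctx.size (x, n) := by rw [Ctx.size_pair]; omega
  have hT := T.eval_nat_mono hx
  have hB := (h x).1.trans (B.eval_nat_mono hx)
  refine ⟨hB, fun v o => ((Exec.hide x n v o).seq (((h x).2 _ o).seq
    (Exec.unhideBelow x (f x) n v o))).mono ?_⟩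
  simp only [Polynomial.eval_add, Polynomial.eval_mul, Polynomial.eval_X, Polynomial.eval_ofNat]
  omega

theorem PolyNat.add {f g : X → ℕ} (hf : PolyNat f) (hg : PolyNat g) :
    PolyNat fun x => f x + g x := by
  obtain ⟨p, T, B, h⟩ := hf
  obtain ⟨q, T', B', h'⟩ := hg
  refine ⟨.seq q (.seq p .add), T + T' + 4 * B + 3, B + B', fun x => ⟨?_, fun v o =>
    (((h' x).2 v o).seq (((h x).2 _ o).seq (Exec.add _ _ _ v o (f x) (g x)))).mono ?_⟩⟩
  · simpa using add_le_add (h x).1 (h' x).1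
  · have := (h x).1
    simp only [Polynomial.eval_add, Polynomial.eval_mul, Polynomial.eval_ofNat]
    omega

theorem PolyNat.sub {f g : X → ℕ} (hf : PolyNat f) (hg : PolyNat g) :
    PolyNat fun x => f x - g x := by
  obtain ⟨p, T, B, h⟩ := hf
  obtain ⟨q, T', B', h'⟩ := hg
  refine ⟨.seq p (.seq q .sub), T + T' + 6 * B' + 3, B, fun x => ⟨(Nat.sub_le _ _).trans (h x).1,
    fun v o => (((h x).2 v o).seq (((h' x).2 _ o).seq (Exec.sub _ _ _ v o (g x) (f x)))).mono ?_⟩⟩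
  have := (h' x).1
  simp only [Polynomial.eval_add, Polynomial.eval_mul, Polynomial.eval_ofNat]
  omega

/-- The summation index is a new variable, and the partial sum is the top intermediate result. -/
theorem PolyNat.sum {f : X → ℕ} {g : X → ℕ → ℕ} (hf : PolyNat f)
    (hg : PolyNat fun x : X × ℕ => g x.1 x.2) :
    PolyNat fun x => ∑ i ∈ Finset.range (f x), g x i := by
  obtain ⟨p, T, B, h⟩ := hf
  obtain ⟨q, T', B', h'⟩ := hg
  have hsize : ∀ x, ∀ i < f x, Ctx.size (x, i) ≤ (Polynomial.X + B).eval (Ctx.size x) := by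
    intro x i hi
    have := (h x).1
    rw [Ctx.size_pair]
    simp only [Polynomial.eval_add, Polynomial.eval_X]
    omega
  have hB' : ∀ x, ∀ i < f x, g x i ≤ (B'.comp (Polynomial.X + B)).eval (Ctx.size x) := by
    intro x i hi
    rw [Polynomial.eval_comp]
    exact (h' (x, i)).1.trans (B'.eval_nat_mono (hsize x i hi))
  refine ⟨.seq p (.seq .bind (.forDown (.seq q .add))),
    T + 2 * B + 4 + B * (T'.comp (Polynomial.X + B) + 4 * B'.comp (Polynomial.X + B) + 5),
    B * B'.comp (Polynomial.X + B), fun x => ⟨?_, fun v o => ?_⟩⟩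
  · refine (Finset.sum_le_card_nsmul _ _ _ fun i hi => hB' x i (Finset.mem_range.1 hi)).trans ?_
    rw [Polynomial.eval_mul, Finset.card_range, smul_eq_mul]
    exact Nat.mul_le_mul_right _ (h x).1
  · have key := Exec.forDown (x := x) (c := .seq q .add)
      (t := (T'.comp (Polynomial.X + B) + 4 * B'.comp (Polynomial.X + B) + 3).eval (Ctx.size x))
      (fun i => blk (∑ j ∈ Finset.Ico i (f x), g x j) ++ v) (fun _ => o) (f x) (by
        intro i hi
        rw [Finset.sum_eq_sum_Ico_succ_bot hi]
        refine (((h' (x, i)).2 _ o).seq (Exec.add _ _ _ v o _ _)).mono ?_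
        have h₁ := hB' x i hi
        have h₂ := T'.eval_nat_mono (hsize x i hi)
        rw [← Polynomial.eval_comp] at h₂
        simp only [Polynomial.eval_add, Polynomial.eval_mul, Polynomial.eval_ofNat]
        omega)
    simp only [Finset.Ico_self, Finset.sum_empty, Nat.Ico_zero_eq_range] at key
    refine (((h x).2 v o).seq ((Exec.bind x (f x) v o).seq key)).mono ?_
    have hfx := (h x).1
    simp only [Polynomial.eval_add, Polynomial.eval_mul, Polynomial.eval_ofNat,
      show ∀ a : ℕ, a + 3 + 2 = a + 5 from fun _ => rfl]
    have := Nat.mul_le_mul_right (Polynomial.eval (Ctx.size x) (T'.comp (Polynomial.X + B)) +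
      4 * Polynomial.eval (Ctx.size x) (B'.comp (Polynomial.X + B)) + 5) hfx
    omega

theorem PolyWord.nil : PolyWord fun _ : X => [] :=
  ⟨.skip, 1, fun x v o => by simpa using Exec.skip (Ctx.mem x v o)⟩

theorem PolyWord.singleton (a : Option Bool) : PolyWord fun _ : X => [a] :=
  ⟨.push .out a, 1, fun x v o => (Exec.push (Ctx.mem x v o) .out a).mono (by simp)⟩

theorem PolyWord.append {f g : X → List (Option Bool)} (hf : PolyWord f) (hg : PolyWord g) :
    PolyWord fun x => f x ++ g x := by
  obtain ⟨p, T, h⟩ := hf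
  obtain ⟨q, T', h'⟩ := hg
  refine ⟨.seq q p, T' + T, fun x v o => ?_⟩
  simpa using (h' x v o).seq (h x v (g x ++ o))

theorem PolyWord.const (l : List (Option Bool)) : PolyWord fun _ : X => l := by
  induction l with
  | nil => exact PolyWord.nil
  | cons a l ih => exact (PolyWord.singleton a).append ih

theorem PolyWord.weaken {g : X → List (Option Bool)} (hg : PolyWord g) :
    PolyWord fun x : X × ℕ => g x.1 := by
  obtain ⟨p, T, h⟩ := hg
  refine ⟨.seq .hide (.seq p .unhide), T + 4 * Polynomial.X + 6, ?_⟩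
  rintro ⟨x, n⟩ v o
  have hx : Ctx.size x ≤ Ctx.size (x, n) := by rw [Ctx.size_pair]; omega
  have hn : n ≤ Ctx.size (x, n) := by rw [Ctx.size_pair]; omega
  have hT := T.eval_nat_mono hx
  refine ((Exec.hide x n v o).seq ((h x _ o).seq (Exec.unhide x n v _))).mono ?_
  simp only [Polynomial.eval_add, Polynomial.eval_mul, Polynomial.eval_X, Polynomial.eval_ofNat]
  omega

/-- The loop runs downwards since the output is written from its end. -/
theorem PolyWord.flatMap {f : X → ℕ} {g : X → ℕ → List (Option Bool)} (hf : PolyNat f)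
    (hg : PolyWord fun x : X × ℕ => g x.1 x.2) :
    PolyWord fun x => (List.range (f x)).flatMap (g x) := by
  obtain ⟨p, T, B, h⟩ := hf
  obtain ⟨q, T', h'⟩ := hg
  refine ⟨.seq p (.seq .bind (.seq (.pop .val) (.forDown q))),
    T + 2 * B + 5 + B * (T'.comp (Polynomial.X + B) + 2), fun x v o => ?_⟩
  have key := Exec.forDown (x := x) (c := q) (t := (T'.comp (Polynomial.X + B)).eval (Ctx.size x))
    (fun _ => v) (fun i => (List.range' i (f x - i)).flatMap (g x) ++ o) (f x) (by
      intro i hi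
      have hi' : f x - i = (f x - (i + 1)) + 1 := by omega
      rw [hi', List.range'_succ, List.flatMap_cons, List.append_assoc]
      refine (h' (x, i) v _).mono ?_
      rw [Polynomial.eval_comp]
      refine T'.eval_nat_mono ?_
      have := (h x).1
      rw [Ctx.size_pair]
      simp only [Polynomial.eval_add, Polynomial.eval_X]
      omega)
  simp only [Nat.sub_self, List.range'_zero, List.flatMap_nil, List.nil_append, Nat.sub_zero,
    ← List.range_eq_range'] at key
  refine (((h x).2 v o).seq ((Exec.bind x (f x) v o).seq ((Exec.pop _ .val).seq key))).mono ?_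
  have hfx := (h x).1
  simp only [Polynomial.eval_add, Polynomial.eval_mul, Polynomial.eval_ofNat]
  have := Nat.mul_le_mul_right (Polynomial.eval (Ctx.size x) (T'.comp (Polynomial.X + B)) + 2) hfx
  omega

end

/-! ### Access to the input -/

/-- The `j`-th symbol of the `f`-th block: `1` for `false`, `2` for `true`, and `0` if there is no
such symbol. -/
def blockDigit (L : List (List Bool)) (f j : ℕ) : ℕ :=
  match (L[f]?.getD [])[j]? with
  | none => 0
  | some false => 1
  | some true => 2

/-- Move the first block of the input to the auxiliary stack. -/
def Cmd.skipBlock : Cmd :=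
  .seq (.loop .inp isBit (.move .inp .aux)) (.cond .inp Option.isSome (.move .inp .aux) .skip)

theorem encodeBlocks_cons (b : List Bool) (L : List (List Bool)) :
    encodeBlocks (b :: L) = b.map some ++ none :: encodeBlocks L := by
  simp [encodeBlocks]

/-- The symbols that have been passed are kept in reverse order on the auxiliary stack. -/
theorem Exec.skipBlock (L : List (List Bool)) (a e v t o : List (Option Bool)) :
    ∃ a', a'.reverse ++ encodeBlocks (L.drop 1) = a.reverse ++ encodeBlocks L ∧
      Exec Cmd.skipBlock ⟨encodeBlocks L, a, e, v, t, o⟩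
        ⟨encodeBlocks (L.drop 1), a', e, v, t, o⟩ (2 * (encodeBlocks L).length + 3) := by
  cases L with
  | nil =>
    exact ⟨a, rfl, ((Exec.loop_false rfl).seq (Exec.cond_false rfl (Exec.skip _))).mono (by simp)⟩
  | cons b L =>
    have h : Exec (.loop .inp isBit (.move .inp .aux)) ⟨encodeBlocks (b :: L), a, e, v, t, o⟩
        ⟨none :: encodeBlocks L, (b.map some).reverse ++ a, e, v, t, o⟩
        (2 * (b.map some).length + 1) := by
      simpa using Exec.loop_move (j := .inp) (k := .aux) (by decide) (t := isBit)
        (r := none :: encodeBlocks L) rfl (l := b.map some)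
        (s := ⟨encodeBlocks (b :: L), a, e, v, t, o⟩) (by simp [encodeBlocks_cons])
        (by rintro _ hc; obtain ⟨c, _, rfl⟩ := List.mem_map.1 hc; rfl)
    refine ⟨none :: ((b.map some).reverse ++ a), ?_,
      (h.seq (Exec.cond_true rfl (Exec.move _ .inp .aux none (encodeBlocks L) rfl))).mono ?_⟩
    · simp [encodeBlocks_cons]
    · simp [encodeBlocks_cons]

theorem Exec.skipBlocks (e v o : List (Option Bool)) (n w : ℕ) :
    ∀ (L : List (List Bool)) (a : List (Option Bool)), (encodeBlocks L).length ≤ w →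
      ∃ a', a'.reverse ++ encodeBlocks (L.drop n) = a.reverse ++ encodeBlocks L ∧
        Exec (.loop .val isMark (.seq (.pop .val) .skipBlock))
          ⟨encodeBlocks L, a, e, blk n ++ v, [], o⟩
          ⟨encodeBlocks (L.drop n), a', e, none :: v, [], o⟩ (n * (2 * w + 5) + 1) := by
  induction n with
  | zero =>
    intro L a _
    exact ⟨a, rfl, (Exec.loop_false rfl).mono (by omega)⟩
  | succ n ih =>
    intro L a hw
    obtain ⟨a₁, h₁, h₂⟩ := Exec.skipBlock L a e (blk n ++ v) [] o
    have hlen : (encodeBlocks (L.drop 1)).length ≤ w := by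
      cases L with
      | nil => simpa using hw
      | cons b L => simp [encodeBlocks_cons] at hw ⊢; omega
    obtain ⟨a₂, h₃, h₄⟩ := ih (L.drop 1) a₁ hlen
    rw [List.drop_drop, Nat.add_comm 1 n] at h₃ h₄
    refine ⟨a₂, h₃.trans h₁, (Exec.loop_true rfl ((Exec.pop _ .val).seq h₂) h₄).mono ?_⟩
    rw [Nat.add_mul]
    omega

theorem Exec.skipBits (e v o r : List (Option Bool)) (hr : isBit r.head? = false) (n : ℕ) :
    ∀ (b : List Bool) (a : List (Option Bool)),
      ∃ a', a'.reverse ++ ((b.drop n).map some ++ r) = a.reverse ++ (b.map some ++ r) ∧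
        Exec (.loop .val isMark (.seq (.pop .val) (.cond .inp isBit (.move .inp .aux) .skip)))
          ⟨b.map some ++ r, a, e, blk n ++ v, [], o⟩
          ⟨(b.drop n).map some ++ r, a', e, none :: v, [], o⟩ (4 * n + 1) := by
  induction n with
  | zero =>
    intro b a
    exact ⟨a, rfl, (Exec.loop_false rfl).mono (by omega)⟩
  | succ n ih =>
    intro b a
    cases b with
    | nil =>
      obtain ⟨a', h₁, h₂⟩ := ih [] a
      rw [List.drop_nil] at h₁ h₂ ⊢
      exact ⟨a', h₁, (Exec.loop_true rfl ((Exec.pop _ .val).seq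
        (Exec.cond_false (by simpa using hr) (Exec.skip _))) h₂).mono (by omega)⟩
    | cons c b =>
      obtain ⟨a', h₁, h₂⟩ := ih b (some c :: a)
      refine ⟨a', by simpa using h₁, (Exec.loop_true rfl ((Exec.pop _ .val).seq
        (Exec.cond_true rfl (Exec.move _ .inp .aux (some c) (b.map some ++ r) rfl))) h₂).mono
        (by omega)⟩

/-- Read the symbol whose position is given by the two top numbers. -/
def Cmd.digit : Cmd :=
  .seq (.loop .val isMark (.seq (.pop .val) .skipBlock)) (.seq (.pop .val)
    (.seq (.loop .val isMark (.seq (.pop .val) (.cond .inp isBit (.move .inp .aux) .skip)))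
      (.seq (.cond .inp (fun o => o == some (some true))
          (.seq (.push .val (some true)) (.push .val (some true)))
          (.cond .inp (fun o => o == some (some false)) (.push .val (some true)) .skip))
        (.loop .aux Option.isSome (.move .aux .inp)))))

theorem Exec.digit (L : List (List Bool)) (e v o : List (Option Bool)) (f j : ℕ) :
    Exec Cmd.digit ⟨encodeBlocks L, [], e, blk f ++ (blk j ++ v), [], o⟩
      ⟨encodeBlocks L, [], e, blk (blockDigit L f j) ++ v, [], o⟩
      (f * (2 * (encodeBlocks L).length + 5) + 4 * j + 2 * (encodeBlocks L).length + 8) := by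
  obtain ⟨a₁, ha₁, h₁⟩ := Exec.skipBlocks e (blk j ++ v) o f _ L [] le_rfl
  obtain ⟨r, hr, hL⟩ : ∃ r : List (Option Bool), isBit r.head? = false ∧
      encodeBlocks (L.drop f) = (L[f]?.getD []).map some ++ r := by
    rcases lt_or_ge f L.length with hf | hf
    · rw [List.drop_eq_getElem_cons hf, encodeBlocks_cons]
      exact ⟨none :: encodeBlocks (L.drop (f + 1)), rfl, by simp [hf]⟩
    · exact ⟨[], rfl, by simp [List.drop_eq_nil_of_le hf, hf, encodeBlocks]⟩
  rw [hL] at ha₁ h₁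
  obtain ⟨a₂, ha₂, h₂⟩ := Exec.skipBits e v o r hr j (L[f]?.getD []) a₁
  have ha := ha₂.trans ha₁
  rw [List.reverse_nil, List.nil_append] at ha
  have hhead : ∀ b, ((((L[f]?.getD []).drop j).map some ++ r).head? = some (some b)) ↔
      (L[f]?.getD [])[j]? = some b := by
    have hl : ∀ (b : Bool) (l : List Bool),
        (l.map some ++ r).head? = some (some b) ↔ l.head? = some b := by
      intro b l
      rcases l with _ | ⟨c, l⟩
      · rcases r with _ | ⟨_ | c, r⟩
        · simp
        · simp
        · simp [isBit] at hr
      · simp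
    intro b
    rw [hl, List.head?_drop]
  set i := ((L[f]?.getD []).drop j).map some ++ r with hi
  have h₃ : Exec (.cond .inp (fun o => o == some (some true))
          (.seq (.push .val (some true)) (.push .val (some true)))
          (.cond .inp (fun o => o == some (some false)) (.push .val (some true)) .skip))
        ⟨i, a₂, e, none :: v, [], o⟩ ⟨i, a₂, e, blk (blockDigit L f j) ++ v, [], o⟩ 3 := by
    unfold blockDigit
    rcases hd : (L[f]?.getD [])[j]? with _ | b
    · refine Exec.cond_false ?_ (Exec.cond_false ?_ (Exec.skip _))
      · simpa [hd] using (hhead true)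
      · simpa [hd] using (hhead false)
    · have hb := (hhead b).2 hd
      cases b
      · refine (Exec.cond_false ?_ (Exec.cond_true ?_ (Exec.push _ .val (some true))))
        · simp [hb]
        · simp [hb]
      · exact Exec.cond_true (by simp [hb]) ((Exec.push _ .val (some true)).seq
          (Exec.push _ .val (some true)))
  have h₄ : Exec (.loop .aux Option.isSome (.move .aux .inp))
      ⟨i, a₂, e, blk (blockDigit L f j) ++ v, [], o⟩
      ⟨encodeBlocks L, [], e, blk (blockDigit L f j) ++ v, [], o⟩ (2 * a₂.length + 1) := by
    rw [← ha]
    simpa using Exec.loop_move (j := .aux) (k := .inp) (by decide) (t := Option.isSome)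
      (r := []) rfl (l := a₂)
      (s := ⟨i, a₂, e, blk (blockDigit L f j) ++ v, [], o⟩) (by simp) (by simp)
  have hlen := congrArg List.length ha
  rw [List.length_append, List.length_reverse] at hlen
  exact (h₁.seq ((Exec.pop _ .val).seq (h₂.seq (h₃.seq h₄)))).mono (by omega)

/-- Push the length of the input. -/
def Cmd.inputLength : Cmd :=
  .seq (.push .val none) (.seq
    (.loop .inp Option.isSome (.seq (.push .val (some true)) (.move .inp .aux)))
    (.loop .aux Option.isSome (.move .aux .inp)))

theorem Exec.inputLength (i e v o : List (Option Bool)) :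
    Exec Cmd.inputLength ⟨i, [], e, v, [], o⟩ ⟨i, [], e, blk i.length ++ v, [], o⟩
      (5 * i.length + 3) := by
  have h₁ : ∀ (i a w : List (Option Bool)),
      Exec (.loop .inp Option.isSome (.seq (.push .val (some true)) (.move .inp .aux)))
        ⟨i, a, e, w, [], o⟩
        ⟨[], i.reverse ++ a, e, List.replicate i.length (some true) ++ w, [], o⟩
        (3 * i.length + 1) := by
    intro i
    induction i with
    | nil => intro a w; exact (Exec.loop_false rfl).mono (by omega)
    | cons b i ih =>
      intro a w
      have h := ih (b :: a) (some true :: w)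
      rw [List.append_cons _ _ w, ← List.replicate_succ'] at h
      rw [List.reverse_cons, List.append_assoc, List.length_cons]
      exact (Exec.loop_true rfl ((Exec.push _ .val (some true)).seq
        (Exec.move _ .inp .aux b i rfl)) h).mono (by omega)
  have h₂ : Exec (.loop .aux Option.isSome (.move .aux .inp))
      ⟨[], i.reverse ++ [], e, List.replicate i.length (some true) ++ none :: v, [], o⟩
      ⟨i, [], e, List.replicate i.length (some true) ++ none :: v, [], o⟩
      (2 * i.length + 1) := by
    simpa using Exec.loop_move (j := .aux) (k := .inp) (by decide) (t := Option.isSome)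
      (r := []) rfl (l := i.reverse)
      (s := ⟨[], i.reverse, e, List.replicate i.length (some true) ++ none :: v, [], o⟩)
      (by simp) (by simp)
  rw [blk_append]
  exact ((Exec.push _ .val none).seq ((h₁ i [] (none :: v)).seq h₂)).mono (by omega)

section

variable {X : Type} [Ctx X]

theorem PolyNat.inputLength : PolyNat fun x : X => (encodeBlocks (Ctx.word x)).length := by
  refine ⟨.inputLength, 5 * Polynomial.X + 3, Polynomial.X, fun x => ?_⟩
  have hx : (encodeBlocks (Ctx.word x)).length ≤ Ctx.size x := by unfold Ctx.size; omega
  refine ⟨by simpa using hx, fun v o => (Exec.inputLength _ _ v o).mono ?_⟩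
  simp only [Polynomial.eval_add, Polynomial.eval_mul, Polynomial.eval_X, Polynomial.eval_ofNat]
  omega

theorem blockDigit_le (L : List (List Bool)) (f j : ℕ) : blockDigit L f j ≤ 2 := by
  unfold blockDigit
  split <;> simp

theorem PolyNat.digit {f j : X → ℕ} (hf : PolyNat f) (hj : PolyNat j) :
    PolyNat fun x => blockDigit (Ctx.word x) (f x) (j x) := by
  obtain ⟨p, T, B, h⟩ := hf
  obtain ⟨q, T', B', h'⟩ := hj
  refine ⟨.seq q (.seq p .digit),
    T + T' + B * (2 * Polynomial.X + 5) + 4 * B' + 2 * Polynomial.X + 8, 2, fun x => ⟨?_, ?_⟩⟩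
  · simpa using blockDigit_le _ _ _
  · intro v o
    refine (((h' x).2 v o).seq (((h x).2 _ o).seq (Exec.digit _ _ v o (f x) (j x)))).mono ?_
    have hf := (h x).1
    have hj := (h' x).1
    have hx : (encodeBlocks (Ctx.word x)).length ≤ Ctx.size x := by unfold Ctx.size; omega
    have := Nat.mul_le_mul hf (show 2 * (encodeBlocks (Ctx.word x)).length + 5 ≤
      2 * Ctx.size x + 5 by omega)
    simp only [Polynomial.eval_add, Polynomial.eval_mul, Polynomial.eval_X, Polynomial.eval_ofNat]
    omega

/-- A function between words is computed by a Turing machine in polynomial time if its values are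
`PolyWord` in a context without variables. -/
theorem PolyWord.nonempty_tm2ComputableInPolyTime {ρ : X → X} (henv : ∀ x : X, Ctx.env x = [])
    (h : PolyWord fun x : X => encodeBlocks (Ctx.word (ρ x))) :
    Nonempty (Turing.TM2ComputableInPolyTime (fun x : X => encodeBlocks (Ctx.word x))
      (fun x : X => encodeBlocks (Ctx.word x)) ρ) := by
  obtain ⟨p, T, h⟩ := h
  have hclear : ∀ i o : List (Option Bool), Exec (.loop .inp Option.isSome (.pop .inp))
      ⟨i, [], [], [], [], o⟩ ⟨[], [], [], [], [], o⟩ (2 * i.length + 1) := by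
    intro i o
    induction i with
    | nil => exact (Exec.loop_false rfl).mono (by simp)
    | cons a i ih => exact (Exec.loop_true rfl (Exec.pop _ .inp) ih).mono (by simp; omega)
  refine nonempty_tm2ComputableInPolyTime_of_exec (.seq p (.loop .inp Option.isSome (.pop .inp)))
    (T + 2 * Polynomial.X + 1) fun x => ?_
  have h₁ := h x [] []
  simp only [Ctx.mem, henv, Ctx.size, List.append_nil, List.length_nil, Nat.add_zero] at h₁
  refine (h₁.seq (hclear _ _)).mono ?_
  simp only [Polynomial.eval_add, Polynomial.eval_mul, Polynomial.eval_X, Polynomial.eval_ofNat,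
    Polynomial.eval_one]
  omega

end

/-! ### Arithmetic and bounded quantification in polynomial time -/

open Classical in
/-- The indicator of a proposition. -/
noncomputable def ind (p : Prop) : ℕ := if p then 1 else 0

section

variable {X : Type} [Ctx X]

/-- The predicate `P` is decided in polynomial time. -/
def PolyPred (P : X → Prop) : Prop := PolyNat fun x => ind (P x)

theorem PolyNat.congr {f g : X → ℕ} (hf : PolyNat f) (h : ∀ x, f x = g x) : PolyNat g := by
  rwa [← funext h]

theorem PolyPred.congr {P Q : X → Prop} (hP : PolyPred P) (h : ∀ x, P x ↔ Q x) : PolyPred Q := by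
  rwa [← funext fun x => propext (h x)]

theorem PolyWord.congr {f g : X → List (Option Bool)} (hf : PolyWord f) (h : ∀ x, f x = g x) :
    PolyWord g := by
  rwa [← funext h]

theorem PolyNat.mul {f g : X → ℕ} (hf : PolyNat f) (hg : PolyNat g) :
    PolyNat fun x => f x * g x :=
  (hf.sum (g := fun x _ => g x) hg.weaken).congr fun x => by simp

theorem PolyPred.lt {f g : X → ℕ} (hf : PolyNat f) (hg : PolyNat g) :
    PolyPred fun x => f x < g x :=
  ((PolyNat.const 1).sub ((PolyNat.const 1).sub (hg.sub hf))).congr fun x => by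
    unfold ind
    split_ifs <;> omega

theorem PolyPred.not {P : X → Prop} (hP : PolyPred P) : PolyPred fun x => ¬P x :=
  ((PolyNat.const 1).sub hP).congr fun x => by
    unfold ind
    split_ifs <;> simp_all

theorem PolyPred.and {P Q : X → Prop} (hP : PolyPred P) (hQ : PolyPred Q) :
    PolyPred fun x => P x ∧ Q x :=
  (PolyNat.mul hP hQ).congr fun x => by
    unfold ind
    split_ifs <;> simp_all

theorem PolyPred.or {P Q : X → Prop} (hP : PolyPred P) (hQ : PolyPred Q) :
    PolyPred fun x => P x ∨ Q x :=
  (hP.not.and hQ.not).not.congr fun _ => by tauto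

theorem PolyPred.iff {P Q : X → Prop} (hP : PolyPred P) (hQ : PolyPred Q) :
    PolyPred fun x => P x ↔ Q x :=
  ((hP.and hQ).or (hP.not.and hQ.not)).congr fun _ => by tauto

theorem PolyPred.le {f g : X → ℕ} (hf : PolyNat f) (hg : PolyNat g) :
    PolyPred fun x => f x ≤ g x :=
  (PolyPred.lt hg hf).not.congr fun _ => not_lt

theorem PolyPred.eq {f g : X → ℕ} (hf : PolyNat f) (hg : PolyNat g) :
    PolyPred fun x => f x = g x :=
  ((PolyPred.le hf hg).and (PolyPred.le hg hf)).congr fun _ => le_antisymm_iff.symm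

theorem PolyNat.card_filter {f : X → ℕ} {P : X → ℕ → Prop} [∀ x, DecidablePred (P x)] (hf : PolyNat f)
    (hP : PolyPred fun x : X × ℕ => P x.1 x.2) :
    PolyNat fun x => ((Finset.range (f x)).filter (P x)).card :=
  (hf.sum (g := fun x i => ind (P x i)) hP).congr fun x => by
    rw [Finset.card_filter]
    refine Finset.sum_congr rfl fun i _ => ?_
    by_cases h : P x i <;> simp [h, ind]

theorem PolyPred.exists_lt {f : X → ℕ} {P : X → ℕ → Prop} (hf : PolyNat f)
    (hP : PolyPred fun x : X × ℕ => P x.1 x.2) : PolyPred fun x => ∃ i < f x, P x i := by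
  classical
  refine (PolyPred.lt PolyNat.zero (hf.card_filter hP)).congr fun x => ?_
  simp [Finset.card_pos, Finset.Nonempty]

theorem PolyPred.forall_lt {f : X → ℕ} {P : X → ℕ → Prop} (hf : PolyNat f)
    (hP : PolyPred fun x : X × ℕ => P x.1 x.2) : PolyPred fun x => ∀ i < f x, P x i :=
  (PolyPred.exists_lt hf (P := fun x i => ¬P x i) hP.not).not.congr fun _ => by
    push Not
    rfl

theorem PolyNat.min {f g : X → ℕ} (hf : PolyNat f) (hg : PolyNat g) :
    PolyNat fun x => min (f x) (g x) :=
  (hf.sub (hf.sub hg)).congr fun _ => by omega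

/-- A quotient counts the numbers `q` with `(q + 1) * g ≤ f`. -/
theorem PolyNat.div {f g : X → ℕ} (hf : PolyNat f) (hg : PolyNat g) :
    PolyNat fun x => f x / g x := by
  classical
  refine (hf.card_filter (P := fun x q => 0 < g x ∧ (q + 1) * g x ≤ f x)
    ((PolyPred.lt PolyNat.zero hg.weaken).and
      (PolyPred.le (PolyNat.var.succ.mul hg.weaken) hf.weaken))).congr fun x => ?_
  rcases Nat.eq_zero_or_pos (g x) with h | h
  · simp [h]
  · rw [← Finset.card_range (f x / g x)]
    congr 1
    ext q
    simp only [Finset.mem_filter, Finset.mem_range, h, true_and, ← Nat.le_div_iff_mul_le h,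
      Nat.add_one_le_iff, and_iff_right_iff_imp]
    exact fun hq => hq.trans_le (Nat.div_le_self _ _)

theorem PolyNat.mod {f g : X → ℕ} (hf : PolyNat f) (hg : PolyNat g) :
    PolyNat fun x => f x % g x :=
  (hf.sub (hg.mul (hf.div hg))).congr fun _ => (Nat.mod_eq_sub _ _).symm

/-- The powers of two are the positive numbers without odd divisors other than `1`. -/
theorem exists_eq_two_pow_iff (z : ℕ) :
    (∃ k, z = 2 ^ k) ↔ 0 < z ∧ ∀ d < z + 1, d % 2 = 1 → z % d = 0 → d = 1 := by
  constructor
  · rintro ⟨k, rfl⟩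
    refine ⟨by positivity, fun d _ hd hdvd => ?_⟩
    obtain ⟨i, -, rfl⟩ := (Nat.dvd_prime_pow Nat.prime_two).1 (Nat.dvd_of_mod_eq_zero hdvd)
    rcases i with _ | i
    · rfl
    · rw [pow_succ] at hd
      omega
  · rintro ⟨hz, h⟩
    rcases Nat.eq_two_pow_or_exists_odd_prime_and_dvd z with ⟨k, hk⟩ | ⟨p, hp, hpz, hodd⟩
    · exact ⟨k, hk⟩
    · have := h p (Nat.lt_succ_of_le (Nat.le_of_dvd hz hpz)) (Nat.odd_iff.1 hodd)
        (Nat.mod_eq_zero_of_dvd hpz)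
      exact absurd this hp.ne_one

theorem PolyPred.exists_eq_two_pow {f : X → ℕ} (hf : PolyNat f) :
    PolyPred fun x => ∃ k, f x = 2 ^ k := by
  refine ((PolyPred.lt PolyNat.zero hf).and (PolyPred.forall_lt hf.succ
    (P := fun x d => ¬(d % 2 = 1 ∧ f x % d = 0 ∧ d ≠ 1)) ?_)).congr fun x => ?_
  · exact ((PolyPred.eq (PolyNat.var.mod (PolyNat.const 2)) (PolyNat.const 1)).and
      ((PolyPred.eq (hf.weaken.mod PolyNat.var) PolyNat.zero).and
        (PolyPred.eq PolyNat.var (PolyNat.const 1)).not)).not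
  · rw [exists_eq_two_pow_iff]
    refine and_congr_right fun _ => forall₂_congr fun d _ => ?_
    tauto

/-- The number of binary digits of `m` is the number of powers of two up to `m`. -/
theorem PolyNat.size {f : X → ℕ} (hf : PolyNat f) : PolyNat fun x => Nat.size (f x) := by
  classical
  refine (hf.succ.card_filter (P := fun _ z => ∃ k, z = 2 ^ k)
    (PolyPred.exists_eq_two_pow PolyNat.var)).congr fun x => ?_
  rw [← Finset.card_range (Nat.size (f x)),
    ← Finset.card_image_of_injective (Finset.range _) (Nat.pow_right_injective le_rfl)]
  congr 1
  ext z
  simp only [Finset.mem_filter, Finset.mem_range, Finset.mem_image, Nat.lt_size]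
  constructor
  · rintro ⟨hz, k, rfl⟩
    exact ⟨k, Nat.le_of_lt_succ hz, rfl⟩
  · rintro ⟨k, hk, rfl⟩
    exact ⟨Nat.lt_succ_of_le hk, k, rfl⟩

/-- `2 ^ i` is the number of all `y` with at most `i` binary digits; counting only the `y` below `M`
avoids numbers of exponential size. -/
theorem PolyNat.min_two_pow {f M : X → ℕ} (hf : PolyNat f) (hM : PolyNat M) :
    PolyNat fun x => Min.min (2 ^ f x) (M x) := by
  classical
  refine (hM.card_filter (P := fun x y => Nat.size y ≤ f x)
    (PolyPred.le PolyNat.var.size hf.weaken)).congr fun x => ?_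
  rw [← Finset.card_range (Min.min (2 ^ f x) (M x))]
  congr 1
  ext y
  simp only [Finset.mem_filter, Finset.mem_range, Nat.size_le, lt_min_iff, and_comm]

/-- In `f / 2 ^ j`, the power may be replaced by its minimum with `f + 1`. -/
theorem PolyPred.testBit {f j : X → ℕ} (hf : PolyNat f) (hj : PolyNat j) :
    PolyPred fun x => (f x).testBit (j x) = true := by
  refine (PolyPred.eq ((hf.div (PolyNat.min_two_pow hj hf.succ)).mod (PolyNat.const 2))
    (PolyNat.const 1)).congr fun x => ?_
  rw [Nat.testBit_eq_decide_div_mod_eq, decide_eq_true_iff]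
  rcases le_total (2 ^ j x) (f x + 1) with h | h
  · rw [min_eq_left h]
  · rw [min_eq_right h, Nat.div_eq_of_lt (Nat.lt_succ_self _),
      Nat.div_eq_of_lt (Nat.lt_of_succ_le h)]

/-- Each branch is a concatenation over a range of length `0` or `1`. -/
theorem PolyWord.ite {P : X → Prop} [DecidablePred P] {f g : X → List (Option Bool)}
    (hP : PolyPred P) (hf : PolyWord f) (hg : PolyWord g) :
    PolyWord fun x => if P x then f x else g x :=
  ((PolyWord.flatMap (g := fun x _ => f x) hP hf.weaken).append
    (PolyWord.flatMap (g := fun x _ => g x) hP.not hg.weaken)).congr fun x => by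
    by_cases h : P x <;> simp [h, ind]

end

/-! ### Binary numbers -/

theorem encodePosNum_eq (p : PosNum) :
    Computability.encodePosNum p = (List.range (p : ℕ).size).map (p : ℕ).testBit := by
  have key : ∀ (b : Bool) (m : ℕ), 0 < m → (List.range (Nat.bit b m).size).map
      (Nat.bit b m).testBit = b :: (List.range m.size).map m.testBit := by
    intro b m hm
    have hne : Nat.bit b m ≠ 0 := Nat.bit_ne_zero b hm.ne'
    rw [Nat.size_bit hne, List.range_succ_eq_map, List.map_cons, List.map_map,
      Nat.testBit_bit_zero]
    congr 1
    refine List.map_congr_left fun j _ => ?_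
    simp [Nat.testBit_bit_succ]
  induction p with
  | one => simp [Computability.encodePosNum]
  | bit0 p ih =>
    have h : ((PosNum.bit0 p : PosNum) : ℕ) = Nat.bit false (p : ℕ) := by
      simp [Nat.bit, two_mul]
    rw [h, key false _ p.cast_pos, Computability.encodePosNum, ih]
  | bit1 p ih =>
    have h : ((PosNum.bit1 p : PosNum) : ℕ) = Nat.bit true (p : ℕ) := by
      simp [Nat.bit, two_mul]
    rw [h, key true _ p.cast_pos, Computability.encodePosNum, ih]

theorem encodeNat_eq (n : ℕ) :
    Computability.encodeNat n = (List.range n.size).map n.testBit := by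
  have h : Computability.encodeNat n = Computability.encodeNum (n : Num) := rfl
  rw [h]
  conv_rhs => rw [← Num.to_of_nat n]
  cases (n : Num) with
  | zero => rfl
  | pos p => exact encodePosNum_eq p

theorem length_encodeNat (n : ℕ) : (Computability.encodeNat n).length = n.size := by
  simp [encodeNat_eq]

theorem getElem?_encodeNat_eq_some_true (n j : ℕ) :
    (Computability.encodeNat n)[j]? = some true ↔ n.testBit j = true := by
  rw [encodeNat_eq]
  simp only [List.getElem?_map, Option.map_eq_some_iff]
  constructor
  · rintro ⟨a, ha, h⟩
    obtain ⟨_, hj⟩ := List.getElem?_eq_some_iff.1 ha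
    rw [List.getElem_range] at hj
    rwa [hj]
  · intro h
    have hj : j < n.size := Nat.lt_size.2 (Nat.ge_two_pow_of_testBit h)
    exact ⟨j, by simp [hj], h⟩

theorem sum_testBit_eq {n m : ℕ} (h : n < 2 ^ m) :
    ∑ j ∈ Finset.range m, ind (n.testBit j = true) * 2 ^ j = n := by
  have key : ∀ m, ∑ j ∈ Finset.range m, ind (n.testBit j = true) * 2 ^ j = n % 2 ^ m := by
    intro m
    induction m with
    | zero => simp [Nat.mod_one]
    | succ m ih =>
      rw [Finset.sum_range_succ, ih, Nat.mod_pow_succ, Nat.testBit_eq_decide_div_mod_eq, mul_comm]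
      congr 2
      rcases Nat.mod_two_eq_zero_or_one (n / 2 ^ m) with h | h <;> simp [h, ind]
  rw [key, Nat.mod_eq_of_lt h]

theorem min_sum_min {ι : Type} (s : Finset ι) (f : ι → ℕ) (M : ℕ) :
    min (∑ i ∈ s, min (f i) M) M = min (∑ i ∈ s, f i) M := by
  classical
  induction s using Finset.induction_on with
  | empty => simp
  | insert a s ha ih =>
    rw [Finset.sum_insert ha, Finset.sum_insert ha]
    omega

theorem flatMap_range_getElem? {α : Type} (l : List α) {N : ℕ} (h : l.length ≤ N) :
    (List.range N).flatMap (fun j => l[j]?.toList) = l := by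
  induction l generalizing N with
  | nil => simp
  | cons a l ih =>
    obtain ⟨N, rfl⟩ : ∃ M, N = M + 1 := ⟨N - 1, by simp at h; omega⟩
    rw [List.range_succ_eq_map, List.flatMap_cons, List.flatMap_map]
    simp only [List.length_cons] at h
    simpa using ih (by omega)

theorem length_le_length_encodeBlocks {L : List (List Bool)} {b : List Bool} (h : b ∈ L) :
    b.length ≤ (encodeBlocks L).length := by
  induction L with
  | nil => simp at h
  | cons a L ih =>
    rw [encodeBlocks_cons]
    rcases List.mem_cons.1 h with rfl | h
    · simp
    · have := ih h
      simp
      omega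

theorem length_getElem?_le (L : List (List Bool)) (f : ℕ) :
    (L[f]?.getD []).length ≤ (encodeBlocks L).length := by
  rcases h : L[f]? with _ | b
  · simp
  · exact length_le_length_encodeBlocks (List.mem_of_getElem? h)

theorem blockDigit_eq_zero_iff (L : List (List Bool)) (f j : ℕ) :
    blockDigit L f j = 0 ↔ (L[f]?.getD [])[j]? = none := by
  unfold blockDigit
  rcases (L[f]?.getD [])[j]? with _ | _ | _ <;> simp

theorem blockDigit_eq_two_iff (L : List (List Bool)) (f j : ℕ) :
    blockDigit L f j = 2 ↔ (L[f]?.getD [])[j]? = some true := by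
  unfold blockDigit
  rcases (L[f]?.getD [])[j]? with _ | _ | _ <;> simp

/-- The number which is written in binary, with the least significant bit first, in a block. -/
noncomputable def blockValue (L : List (List Bool)) (f : ℕ) : ℕ :=
  ∑ j ∈ Finset.range (encodeBlocks L).length, ind (blockDigit L f j = 2) * 2 ^ j

theorem blockValue_eq {L : List (List Bool)} {f c : ℕ}
    (h : L[f]?.getD [] = Computability.encodeNat c) : blockValue L f = c := by
  have hlen : c.size ≤ (encodeBlocks L).length := by
    rw [← length_encodeNat, ← h]
    exact length_getElem?_le _ _
  conv_rhs => rw [← sum_testBit_eq (Nat.size_le.1 hlen)]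
  refine Finset.sum_congr rfl fun j _ => ?_
  rw [blockDigit_eq_two_iff, h, getElem?_encodeNat_eq_some_true]

section

variable {X : Type} [Ctx X]

theorem PolyNat.length_block {f : X → ℕ} (hf : PolyNat f) :
    PolyNat fun x => ((Ctx.word x)[f x]?.getD []).length := by
  classical
  refine (PolyNat.inputLength.card_filter (P := fun x j => blockDigit (Ctx.word x) (f x) j ≠ 0)
    (PolyPred.eq (hf.weaken.digit PolyNat.var) PolyNat.zero).not).congr fun x => ?_
  rw [← Finset.card_range ((Ctx.word x)[f x]?.getD []).length]
  congr 1
  ext j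
  have := length_getElem?_le (Ctx.word x) (f x)
  simp only [Finset.mem_filter, Finset.mem_range, ne_eq, blockDigit_eq_zero_iff, List.getElem?_eq_none_iff]
  omega

theorem PolyWord.block {f : X → ℕ} (hf : PolyNat f) :
    PolyWord fun x => ((Ctx.word x)[f x]?.getD []).map some := by
  classical
  refine (PolyWord.flatMap PolyNat.inputLength
    (g := fun x j => if blockDigit (Ctx.word x) (f x) j = 2 then [some true] else
      if blockDigit (Ctx.word x) (f x) j = 1 then [some false] else [])
    (PolyWord.ite (PolyPred.eq (hf.weaken.digit PolyNat.var) (PolyNat.const 2)) (PolyWord.const _)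
    (PolyWord.ite (PolyPred.eq (hf.weaken.digit PolyNat.var) (PolyNat.const 1)) (PolyWord.const _)
      PolyWord.nil))).congr fun x => ?_
  rw [← flatMap_range_getElem? (((Ctx.word x)[f x]?.getD []).map some)
    (by simpa using length_getElem?_le (Ctx.word x) (f x))]
  congr 1
  funext j
  rw [List.getElem?_map]
  unfold blockDigit
  rcases ((Ctx.word x)[f x]?.getD [])[j]? with _ | _ | _ <;> simp

/-- A number written in binary in the input can be exponentially large, but its minimum with a
polynomially bounded number is computed in polynomial time. -/
theorem PolyNat.min_blockValue {f M : X → ℕ} (hf : PolyNat f) (hM : PolyNat M) :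
    PolyNat fun x => Min.min (blockValue (Ctx.word x) (f x)) (M x) := by
  refine ((PolyNat.inputLength.sum
    (g := fun x j => ind (blockDigit (Ctx.word x) (f x) j = 2) * Min.min (2 ^ j) (M x))
    (PolyNat.mul (PolyPred.eq (hf.weaken.digit PolyNat.var) (PolyNat.const 2))
      (PolyNat.min_two_pow PolyNat.var hM.weaken))).min hM).congr fun x => ?_
  conv_rhs => rw [blockValue, ← min_sum_min]
  congr 1
  refine Finset.sum_congr rfl fun j _ => ?_
  by_cases h : blockDigit (Ctx.word x) (f x) j = 2 <;> simp [h, ind]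

theorem PolyWord.encodeNat {f : X → ℕ} (hf : PolyNat f) :
    PolyWord fun x => (Computability.encodeNat (f x)).map some := by
  classical
  refine (PolyWord.flatMap hf.size
    (g := fun x j => if (f x).testBit j = true then [some true] else [some false])
    (PolyWord.ite (PolyPred.testBit hf.weaken PolyNat.var) (PolyWord.const _)
      (PolyWord.const _))).congr fun x => ?_
  rw [encodeNat_eq, List.map_map, List.map_eq_flatMap]
  congr 1
  funext j
  cases h : (f x).testBit j <;> simp [h]

end

/-! ### Neighborhood complexity of graphs of bounded twin-width -/

theorem Trigraph.HasSequence.redDegreeLE {d n : ℕ} {H : Trigraph (Fin n)}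
    (h : Trigraph.HasSequence d n H) : H.RedDegreeLE d := by
  cases h with
  | base _ hn =>
    intro v
    have : H.red.neighborSet v = ∅ := by
      have : Subsingleton (Fin n) := Fin.subsingleton_iff_le_one.2 hn
      ext w
      simp [Subsingleton.elim w v]
    simp [this]
  | step _ _ _ _ _ hdeg _ _ => exact hdeg

namespace SimpleGraph

variable {V : Type}

/-- The trigraph `H` on the parts of a vertex partition, given by `φ`, represents `G`: between
distinct parts which are not joined by a red edge, there are all edges or none. -/
def RepresentedBy {n : ℕ} (G : SimpleGraph V) (φ : V → Fin n) (H : Trigraph (Fin n)) : Prop :=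
  ∀ p q, φ p ≠ φ q → ¬H.red.Adj (φ p) (φ q) → (G.Adj p q ↔ H.black.Adj (φ p) (φ q))

theorem RepresentedBy.contract {n m : ℕ} {G : SimpleGraph V} {φ : V → Fin n} {H : Trigraph (Fin n)}
    {H' : Trigraph (Fin m)} {u v : Fin n} {π : Fin n → Fin m} (h : G.RepresentedBy φ H)
    (hc : H.IsContraction H' u v π) : G.RepresentedBy (π ∘ φ) H' := by
  have hdisj : ∀ x y, H.black.Adj x y → ¬H.red.Adj x y := fun x y hb hr =>
    SimpleGraph.disjoint_left.1 H.disjoint x y hb hr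
  have huv : π u = π v := (hc.identify u v).2 (Or.inr (Or.inl ⟨rfl, rfl⟩))
  -- an edge between a merged part and another part
  have key : ∀ p q, φ p = u ∨ φ p = v → φ q ≠ u → φ q ≠ v → ¬H'.red.Adj (π u) (π (φ q)) →
      (G.Adj p q ↔ H'.black.Adj (π u) (π (φ q))) := by
    intro p q hp hu hv hr
    rw [hc.red_new _ hu hv] at hr
    rw [hc.black_new _ hu hv]
    have hpq : φ p ≠ φ q := by rintro h'; rcases hp with hp | hp <;> simp_all
    by_cases hb : H.black.Adj u (φ q) ∧ H.black.Adj v (φ q)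
    · have : H.black.Adj (φ p) (φ q) := by rcases hp with hp | hp <;> rw [hp]; exacts [hb.1, hb.2]
      rw [h p q hpq (hdisj _ _ this)]
      exact ⟨fun _ => hb, fun _ => this⟩
    · have hn : ¬(H.TotalAdj u (φ q) ∨ H.TotalAdj v (φ q)) := fun hn => hr ⟨hn, hb⟩
      unfold Trigraph.TotalAdj at hn
      have h₁ : ¬H.red.Adj (φ p) (φ q) := by rcases hp with hp | hp <;> rw [hp] <;> tauto
      have h₂ : ¬H.black.Adj (φ p) (φ q) := by rcases hp with hp | hp <;> rw [hp] <;> tauto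
      rw [h p q hpq h₁]
      tauto
  have hπ : ∀ a, a = u ∨ a = v → π a = π u := by rintro a (rfl | rfl) <;> simp [huv]
  intro p q hpq hr
  simp only [Function.comp_apply] at hpq hr ⊢
  by_cases hp : φ p = u ∨ φ p = v
  · by_cases hq : φ q = u ∨ φ q = v
    · exact absurd ((hπ _ hp).trans (hπ _ hq).symm) hpq
    · rw [hπ _ hp] at hr ⊢
      exact key p q hp (fun h => hq (Or.inl h)) (fun h => hq (Or.inr h)) hr
  · by_cases hq : φ q = u ∨ φ q = v
    · rw [hπ _ hq, SimpleGraph.adj_comm] at hr ⊢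
      rw [G.adj_comm, SimpleGraph.adj_comm]
      rw [H'.black.adj_comm]
      exact key q p hq (fun h => hp (Or.inl h)) (fun h => hp (Or.inr h)) hr
    · push Not at hp hq
      rw [hc.red_rest _ _ hp.1 hp.2 hq.1 hq.2] at hr
      rw [hc.black_rest _ _ hp.1 hp.2 hq.1 hq.2]
      exact h p q (fun h' => hpq (by rw [h'])) hr

variable [Fintype V] [DecidableEq V]

open Classical in
/-- The traces on `X` of the neighborhoods of the vertices of `G`. -/
noncomputable def traces (G : SimpleGraph V) (X : Finset V) : Finset (Finset V) :=
  Finset.univ.image fun v => X.filter (G.Adj v)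

/-- If two vertices `x` and `x'` of `X` lie in the same part, and each part contains at most two
vertices of `X`, then few traces on `X` distinguish `x` from `x'`: the vertices with these traces lie
in the part of `x` or in one of its red neighbors, and the traces of the vertices of a part differ
only in the part itself and in its red neighbors. -/
theorem card_traces_distinguishing_le {n d : ℕ} {G : SimpleGraph V} {φ : V → Fin n}
    {H : Trigraph (Fin n)} (h : G.RepresentedBy φ H) (hd : H.RedDegreeLE d) {X : Finset V}
    (hX : ∀ a, (X.filter fun z => φ z = a).card ≤ 2) {x x' : V} (hx : x ∈ X) (hx' : x' ∈ X)
    (hφ : φ x = φ x') :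
    ((G.traces X).filter fun T => ¬(x ∈ T ↔ x' ∈ T)).card ≤ (d + 1) * 2 ^ (2 * (d + 1)) := by
  classical
  let N : Fin n → Finset (Fin n) := fun a => insert a (Finset.univ.filter (H.red.Adj a))
  have hN : ∀ a, (N a).card ≤ d + 1 := by
    intro a
    refine (Finset.card_insert_le _ _).trans (Nat.succ_le_succ ?_)
    have := hd a
    rwa [Set.ncard_eq_toFinset_card', Set.toFinset_card, Fintype.card_subtype] at this
  have hhom : ∀ p q, φ q ∉ N (φ p) → (G.Adj p q ↔ H.black.Adj (φ p) (φ q)) := by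
    intro p q hpq
    simp only [N, Finset.mem_insert, Finset.mem_filter, Finset.mem_univ, true_and, not_or] at hpq
    exact h p q (Ne.symm hpq.1) hpq.2
  have hsub : ((G.traces X).filter fun T => ¬(x ∈ T ↔ x' ∈ T)) ⊆
      (N (φ x)).biUnion fun Q =>
        (Finset.univ.filter fun y => φ y = Q).image fun y => X.filter (G.Adj y) := by
    intro T hT
    simp only [traces, Finset.mem_filter, Finset.mem_image, Finset.mem_univ, true_and] at hT
    obtain ⟨⟨y, rfl⟩, hy⟩ := hT
    simp only [Finset.mem_filter, hx, hx', true_and] at hy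
    simp only [Finset.mem_biUnion, Finset.mem_image, Finset.mem_filter, Finset.mem_univ, true_and]
    refine ⟨φ y, ?_, y, rfl, rfl⟩
    by_contra hyx
    have hxy : φ x ∉ N (φ y) := by
      simp only [N, Finset.mem_insert, Finset.mem_filter, Finset.mem_univ, true_and, not_or] at hyx ⊢
      exact ⟨Ne.symm hyx.1, fun h' => hyx.2 h'.symm⟩
    exact hy (by rw [hhom y x hxy, hhom y x' (hφ ▸ hxy), hφ])
  refine (Finset.card_le_card hsub).trans ((Finset.card_biUnion_le_card_mul _ _ (2 ^ (2 * (d + 1)))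
    fun Q _ => ?_).trans (Nat.mul_le_mul_right _ (hN _)))
  let Z := X.filter fun z => φ z ∈ N Q
  have hZ : Z.card ≤ 2 * (d + 1) :=
    (Finset.card_le_mul_card_image_of_maps_to (f := φ) (t := N Q)
      (fun z hz => (Finset.mem_filter.1 hz).2) 2 fun a _ =>
        (Finset.card_le_card (Finset.filter_subset_filter _ (Finset.filter_subset _ _))).trans
          (hX a)).trans (Nat.mul_le_mul_left _ (hN Q))
  refine le_trans ?_ (Nat.pow_le_pow_right two_pos hZ)
  rw [← Finset.card_powerset]
  refine Finset.card_le_card_of_injOn (fun T => T ∩ Z)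
    (fun T _ => Finset.mem_powerset.2 Finset.inter_subset_right) ?_
  intro T hT T' hT' hTT'
  simp only [Finset.coe_image, Finset.coe_filter, Finset.mem_univ, true_and, Set.mem_image,
    Set.mem_ofPred_eq] at hT hT'
  obtain ⟨y, hy, rfl⟩ := hT
  obtain ⟨y', hy', rfl⟩ := hT'
  ext z
  by_cases hzZ : z ∈ Z
  · simpa [hzZ] using congrArg (fun S : Finset V => z ∈ S) hTT'
  · simp only [Finset.mem_filter]
    refine and_congr_right fun hz => ?_
    have hzN : φ z ∉ N Q := fun h' => hzZ (Finset.mem_filter.2 ⟨hz, h'⟩)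
    rw [hhom y z (hy ▸ hzN), hhom y' z (hy' ▸ hzN), hy, hy']

/-- Consider the first contraction which identifies two vertices `x` and `x'` of `X`. -/
theorem exists_few_traces_distinguishing {n d : ℕ} {G : SimpleGraph V} {H : Trigraph (Fin n)}
    (hH : Trigraph.HasSequence d n H) {X : Finset V} (hX : 2 ≤ X.card) :
    ∀ φ : V → Fin n, G.RepresentedBy φ H → Set.InjOn φ X →
      ∃ x ∈ X, ∃ x' ∈ X, x ≠ x' ∧
        ((G.traces X).filter fun T => ¬(x ∈ T ↔ x' ∈ T)).card ≤ (d + 1) * 2 ^ (2 * (d + 1)) := by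
  induction hH with
  | @base n H hn =>
    intro φ _ hφ
    have := Finset.card_le_card_of_injOn φ (t := Finset.univ) (by simp) hφ
    simp at this
    omega
  | @step n H H' u v π hdeg hc hseq ih =>
    intro φ hrep hφ
    have hrep' := hrep.contract hc
    by_cases hinj : Set.InjOn (π ∘ φ) X
    · exact ih (π ∘ φ) hrep' hinj
    · simp only [Set.InjOn, not_forall] at hinj
      obtain ⟨x, hx, x', hx', hxx', hne⟩ := hinj
      refine ⟨x, hx, x', hx', hne, card_traces_distinguishing_le hrep' hseq.redDegreeLE
        (fun a => ?_) hx hx' hxx'⟩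
      by_contra! hcard
      obtain ⟨p, hp, q, hq, r, hr, hpq, hpr, hqr⟩ := Finset.two_lt_card.1 hcard
      simp only [Finset.mem_filter, Function.comp_apply] at hp hq hr
      have h₁ := (hc.identify _ _).1 (hp.2.trans hq.2.symm)
      have h₂ := (hc.identify _ _).1 (hp.2.trans hr.2.symm)
      have h₃ := (hc.identify _ _).1 (hq.2.trans hr.2.symm)
      have h₄ : φ p ≠ φ q := fun h => hpq (hφ hp.1 hq.1 h)
      have h₅ : φ p ≠ φ r := fun h => hpr (hφ hp.1 hr.1 h)
      have h₆ : φ q ≠ φ r := fun h => hqr (hφ hq.1 hr.1 h)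
      grind

end SimpleGraph

/-- Graphs of bounded twin-width have linear neighborhood complexity: if few traces on `X`
distinguish `x` from `x'`, then few traces are lost when `x` is removed from `X`. -/
theorem FinGraph.TwinWidthLE.card_traces_le {G : FinGraph} {d : ℕ} (h : G.TwinWidthLE d)
    (X : Finset (Fin G.n)) :
    (G.graph.traces X).card ≤ (d + 1) * 2 ^ (2 * (d + 1)) * X.card + 2 := by
  classical
  induction hk : X.card generalizing X with
  | zero =>
    have hsub : G.graph.traces X ⊆ X.powerset := by
      intro T hT
      obtain ⟨y, -, rfl⟩ := Finset.mem_image.1 hT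
      exact Finset.mem_powerset.2 (Finset.filter_subset _ _)
    have := Finset.card_le_card hsub
    rw [Finset.card_powerset, hk] at this
    omega
  | succ k ih =>
    rcases Nat.eq_zero_or_pos k with rfl | hk'
    · have hsub : G.graph.traces X ⊆ X.powerset := by
        intro T hT
        obtain ⟨y, -, rfl⟩ := Finset.mem_image.1 hT
        exact Finset.mem_powerset.2 (Finset.filter_subset _ _)
      have := Finset.card_le_card hsub
      rw [Finset.card_powerset, hk] at this
      omega
    · obtain ⟨x, hx, x', hx', hne, hcard⟩ := SimpleGraph.exists_few_traces_distinguishing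
        (G := G.graph) h (X := X) (by omega) id (fun p q _ _ => Iff.rfl) (Set.injOn_id _)
      have h₁ := ih (X.erase x) (by rw [Finset.card_erase_of_mem hx, hk]; rfl)
      have h₂ : ((G.graph.traces X).filter fun T => (x ∈ T ↔ x' ∈ T)).card ≤
          (G.graph.traces (X.erase x)).card := by
        refine Finset.card_le_card_of_injOn (fun T => T.erase x) ?_ ?_
        · intro T hT
          obtain ⟨hT, -⟩ := Finset.mem_filter.1 hT
          obtain ⟨y, -, rfl⟩ := Finset.mem_image.1 hT
          refine Finset.mem_image.2 ⟨y, Finset.mem_univ _, ?_⟩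
          ext z
          simp only [Finset.mem_filter, Finset.mem_erase]
          tauto
        · intro T hT T' hT' hTT'
          have hT := (Finset.mem_filter.1 hT).2
          have hT' := (Finset.mem_filter.1 hT').2
          have hmem : ∀ z, z ≠ x → (z ∈ T ↔ z ∈ T') := fun z hz => by
            simpa [hz] using congrArg (fun S : Finset (Fin G.n) => z ∈ S) hTT'
          ext z
          by_cases hz : z = x
          · rw [hz, hT, hT', hmem x' hne.symm]
          · exact hmem z hz
      have h₃ := Finset.card_filter_add_card_filter_not (s := G.graph.traces X)
        (fun T => (x ∈ T ↔ x' ∈ T))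
      rw [Nat.mul_add]
      omega

open Classical in
/-- If `S` is a vertex cover and `K` contains at most `k + 1` vertices with any given neighborhood,
then `K` has size quadratic in `k`, as the vertices outside `S` have their neighborhoods in `S`. -/
theorem FinGraph.TwinWidthLE.card_le_of_isVertexCover {G : FinGraph} {d : ℕ} (h : G.TwinWidthLE d)
    {k : ℕ} {S K : Finset (Fin G.n)} (hS : G.graph.IsVertexCover (S : Set (Fin G.n)))
    (hk : S.card ≤ k)
    (hK : ∀ v, (K.filter fun w => ∀ u, G.graph.Adj v u ↔ G.graph.Adj w u).card ≤ k + 1) :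
    K.card ≤ (2 * ((d + 1) * 2 ^ (2 * (d + 1))) + 5) * (k ^ 2 + 1) := by
  set c := (d + 1) * 2 ^ (2 * (d + 1)) with hc
  have h₁ : (K \ S).card ≤ (k + 1) * (G.graph.traces S).card := by
    refine Finset.card_le_mul_card_image_of_maps_to (f := fun v => S.filter (G.graph.Adj v))
      (fun v _ => Finset.mem_image_of_mem _ (Finset.mem_univ v)) _ fun T _ => ?_
    rcases (({v ∈ K \ S | S.filter (G.graph.Adj v) = T}) : Finset _).eq_empty_or_nonempty with
      he | ⟨v, hv⟩
    · simp [he]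
    · refine le_trans (Finset.card_le_card ?_) (hK v)
      intro w hw
      simp only [Finset.mem_filter, Finset.mem_sdiff] at hv hw ⊢
      refine ⟨hw.1.1, fun u => ?_⟩
      have hcov : ∀ v, v ∉ S → (G.graph.Adj v u ↔ u ∈ S.filter (G.graph.Adj v)) := by
        intro v hv
        rw [Finset.mem_filter]
        refine ⟨fun ha => ⟨?_, ha⟩, And.right⟩
        exact (hS ha).resolve_left hv
      rw [hcov v hv.1.2, hcov w hw.1.2, hv.2, hw.2]
  have h₂ := h.card_traces_le S
  have h₃ : K.card ≤ (K \ S).card + S.card := by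
    rw [← Finset.card_sdiff_add_card_inter K S]
    exact Nat.add_le_add_left (Finset.card_le_card Finset.inter_subset_right) _
  have h₄ : (G.graph.traces S).card ≤ c * k + 2 :=
    h₂.trans (Nat.add_le_add_right (Nat.mul_le_mul_left _ hk) _)
  have h₅ := h₁.trans (Nat.mul_le_mul_left (k + 1) h₄)
  have h₆ : k ≤ k ^ 2 := Nat.le_self_pow two_ne_zero k
  have h₇ : c * k ≤ c * k ^ 2 := Nat.mul_le_mul_left _ h₆
  nlinarith

/-! ### The reduction rule -/

namespace SimpleGraph

section

variable {n : ℕ} (G : SimpleGraph (Fin n)) (c : Fin n → ℕ) (k : ℕ)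

/-- `j` is a false twin of `i` of larger capacity, ties being broken by the order of the
vertices. -/
def Better (i j : Fin n) : Prop :=
  (∀ l, G.Adj i l ↔ G.Adj j l) ∧ (c i < c j ∨ c i = c j ∧ i < j)

open Classical in
/-- The vertices removed by the kernelization: all but the best `k + 1` vertices of each class of
false twins. -/
noncomputable def removed : Finset (Fin n) :=
  Finset.univ.filter fun i => k < (Finset.univ.filter fun j => G.Better c i j).card

variable {G c k}

theorem Better.trans {i j l : Fin n} (h : G.Better c i j) (h' : G.Better c j l) :
    G.Better c i l := by
  refine ⟨fun m => (h.1 m).trans (h'.1 m), ?_⟩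
  have h₁ := h.2
  have h₂ := h'.2
  omega

theorem Better.le {i j : Fin n} (h : G.Better c i j) : c i ≤ c j := by
  rcases h.2 with h | h <;> omega

theorem not_better_self (i : Fin n) : ¬G.Better c i i := by
  rintro ⟨-, h⟩
  omega

theorem Better.not_adj {i j : Fin n} (h : G.Better c i j) : ¬G.Adj i j := fun hij =>
  G.irrefl ((h.1 j).1 hij)

open Classical in
/-- A removed vertex has more than `k` better false twins which are not removed: apply induction to a
better twin that is removed. -/
theorem lt_card_better_of_mem_removed {i : Fin n} (hi : i ∈ G.removed c k) :
    k < (Finset.univ.filter fun j => j ∉ G.removed c k ∧ G.Better c i j).card := by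
  induction hm : (Finset.univ.filter fun j => G.Better c i j).card using Nat.strong_induction_on
    generalizing i with
  | _ m ih =>
    subst hm
    by_cases h : ∃ j ∈ G.removed c k, G.Better c i j
    · obtain ⟨j, hj, hij⟩ := h
      refine (ih _ (Finset.card_lt_card ?_) hj rfl).trans_le (Finset.card_le_card ?_)
      · refine Finset.ssubset_iff_of_subset (fun l hl => ?_) |>.2 ⟨j, by simpa using hij, by
          simpa using not_better_self j⟩
        simp only [Finset.mem_filter, Finset.mem_univ, true_and] at hl ⊢
        exact hij.trans hl
      · intro l hl
        simp only [Finset.mem_filter, Finset.mem_univ, true_and] at hl ⊢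
        exact ⟨hl.1, hij.trans hl.2⟩
    · push Not at h
      refine lt_of_lt_of_le (Finset.mem_filter.1 hi).2 (Finset.card_le_card fun l hl => ?_)
      simp only [Finset.mem_filter, Finset.mem_univ, true_and] at hl ⊢
      exact ⟨fun hl' => h l hl' hl, hl⟩

theorem exists_better_notMem {i : Fin n} (hi : i ∈ G.removed c k) {S : Finset (Fin n)}
    (hS : S.card ≤ k) : ∃ j ∉ G.removed c k, G.Better c i j ∧ j ∉ S := by
  classical
  obtain ⟨j, hj, hjS⟩ := Finset.exists_mem_notMem_of_card_lt_card
    (hS.trans_lt (lt_card_better_of_mem_removed hi))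
  simp only [Finset.mem_filter, Finset.mem_univ, true_and] at hj
  exact ⟨j, hj.1, hj.2, hjS⟩

open Classical in
/-- At most `k + 1` vertices of each class of false twins are kept: the worst of them has at most
`k` better twins. -/
theorem card_kept_twins_le (v : Fin n) :
    ((Finset.univ.filter fun w => w ∉ G.removed c k).filter
      fun w => ∀ u, G.Adj v u ↔ G.Adj w u).card ≤ k + 1 := by
  set W := ((Finset.univ.filter fun w => w ∉ G.removed c k).filter
    fun w => ∀ u, G.Adj v u ↔ G.Adj w u) with hW
  rcases W.eq_empty_or_nonempty with he | hne
  · simp [he]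
  · obtain ⟨w, hw, hmin⟩ := Finset.exists_min_image W (fun w => toLex (c w, w)) hne
    have hw' := hw
    simp only [hW, Finset.mem_filter, Finset.mem_univ, true_and] at hw
    have hB : (Finset.univ.filter fun j => G.Better c w j).card ≤ k := by
      have := hw.1
      simp only [removed, Finset.mem_filter, Finset.mem_univ, true_and, not_lt] at this
      exact this
    rw [← Finset.card_erase_add_one hw']
    refine Nat.succ_le_succ (le_trans (Finset.card_le_card fun u hu => ?_) hB)
    obtain ⟨hne, hu⟩ := Finset.mem_erase.1 hu
    have h₁ := hmin u hu
    simp only [hW, Finset.mem_filter, Finset.mem_univ, true_and] at hu ⊢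
    refine ⟨fun l => (hw.2 l).symm.trans (hu.2 l), ?_⟩
    rw [Prod.Lex.toLex_le_toLex] at h₁
    rcases h₁ with h₁ | ⟨h₁, h₂⟩
    · exact Or.inl h₁
    · exact Or.inr ⟨h₁, lt_of_le_of_ne h₂ (Ne.symm hne)⟩

/-- The parameter may be truncated, since no vertex has more than `n` twins. -/
theorem removed_min : G.removed c (min k n) = G.removed c k := by
  classical
  ext i
  simp only [removed, Finset.mem_filter, Finset.mem_univ, true_and]
  have : (Finset.univ.filter fun j => G.Better c i j).card ≤ n := by
    simpa using Finset.card_le_univ (Finset.univ.filter fun j => G.Better c i j)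
  omega

/-- Exchanging two false twins is an automorphism. -/
theorem Better.adj_swap {i j : Fin n} (h : G.Better c i j) (a b : Fin n) :
    G.Adj (Equiv.swap i j a) (Equiv.swap i j b) ↔ G.Adj a b := by
  have h₁ := h.1
  have h₂ : ∀ l, G.Adj l i ↔ G.Adj l j := fun l => by rw [G.adj_comm, h₁, G.adj_comm]
  have h₃ := h.not_adj
  have h₄ : ¬G.Adj j i := fun h' => h₃ h'.symm
  have h₅ : ∀ a, ¬G.Adj a a := fun a => G.irrefl
  simp only [Equiv.swap_apply_def]
  split_ifs <;> simp_all

/-- A property of small vertex sets that is preserved by exchanging a vertex of the set for a better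
false twin holds for a set without removed vertices, if it holds at all. -/
theorem exists_disjoint_removed {P : Finset (Fin n) → Prop}
    (hP : ∀ S i j, P S → i ∈ S → j ∉ S → G.Better c i j → P (S.map (Equiv.swap i j).toEmbedding))
    {S : Finset (Fin n)} (hS : P S) (hk : S.card ≤ k) :
    ∃ S, P S ∧ S.card ≤ k ∧ ∀ v ∈ S, v ∉ G.removed c k := by
  classical
  induction hm : (S ∩ G.removed c k).card using Nat.strong_induction_on generalizing S with
  | _ m ih =>
    subst hm
    by_cases h : ∃ i ∈ S, i ∈ G.removed c k
    · obtain ⟨i, hiS, hi⟩ := h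
      obtain ⟨j, hj, hij, hjS⟩ := exists_better_notMem hi hk
      refine ih _ (Finset.card_lt_card ?_) (hP S i j hS hiS hjS hij) (by simpa using hk) rfl
      have hmem : ∀ v, v ∈ S.map (Equiv.swap i j).toEmbedding ↔ Equiv.swap i j v ∈ S := by
        intro v
        rw [Finset.mem_map_equiv, Equiv.symm_swap]
      refine Finset.ssubset_iff_of_subset (fun v hv => ?_) |>.2 ⟨i, by simp [hiS, hi], by
        simp [hjS]⟩
      simp only [Finset.mem_inter, hmem] at hv ⊢
      refine ⟨?_, hv.2⟩
      have hvj : v ≠ j := fun h => hj (h ▸ hv.2)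
      by_cases hvi : v = i
      · rwa [hvi]
      · rw [Equiv.swap_apply_of_ne_of_ne hvi hvj] at hv
        exact hv.1
    · push Not at h
      exact ⟨S, hS, hk, h⟩

/-- A small vertex cover of the kept vertices covers the whole graph: each removed vertex has a kept
false twin outside the cover. -/
theorem isVertexCover_of_kept {S : Finset (Fin n)} (hk : S.card ≤ k)
    (h : ∀ a b, a ∉ G.removed c k → b ∉ G.removed c k → G.Adj a b → a ∈ S ∨ b ∈ S) :
    G.IsVertexCover (S : Set (Fin n)) := by
  have key : ∀ a, ∀ b, b ∉ G.removed c k → G.Adj a b → a ∈ S ∨ b ∈ S := by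
    intro a b hb hab
    by_cases ha : a ∈ G.removed c k
    · obtain ⟨j, hj, hij, hjS⟩ := exists_better_notMem ha hk
      exact Or.inr ((h j b hj hb ((hij.1 b).1 hab)).resolve_left hjS)
    · exact h a b ha hb hab
  intro a b hab
  simp only [Finset.mem_coe]
  by_cases hb : b ∈ G.removed c k
  · obtain ⟨j, hj, hij, hjS⟩ := exists_better_notMem hb hk
    exact Or.inl ((key a j hj ((hij.1 a).1 hab.symm).symm).resolve_right hjS)
  · exact key a b hb hab

end

/-! ### Connected vertex covers -/

section

variable {n m : ℕ} {G : SimpleGraph (Fin n)} {c : Fin n → ℕ} {k : ℕ} {f : Fin m ↪ Fin n}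

theorem connectedVertexCover_kept_iff (hf : ∀ v, v ∈ Set.range f ↔ v ∉ G.removed c k) :
    (∃ S : Finset (Fin m), S.card ≤ k ∧ (G.comap f).IsVertexCover (S : Set (Fin m)) ∧
      ((G.comap f).induce (S : Set (Fin m))).Connected) ↔
    ∃ S : Finset (Fin n), S.card ≤ k ∧ G.IsVertexCover (S : Set (Fin n)) ∧
      (G.induce (S : Set (Fin n))).Connected := by
  classical
  -- the subgraph induced by a set of kept vertices is the same in both graphs
  have hiso : ∀ S : Finset (Fin m), Nonempty
      ((G.comap f).induce (S : Set (Fin m)) ≃g G.induce ((S.map f : Finset (Fin n)) : Set (Fin n))) := by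
    intro S
    refine ⟨⟨(Equiv.Set.image f (S : Set (Fin m)) f.injective).trans
      (Equiv.setCongr (by simp)), ?_⟩⟩
    intro a b
    rfl
  constructor
  · rintro ⟨S, hk, hcov, hconn⟩
    refine ⟨S.map f, by simpa using hk, isVertexCover_of_kept (c := c) (by simpa using hk) ?_,
      (hiso S).some.connected_iff.1 hconn⟩
    intro a b ha hb hab
    obtain ⟨a, rfl⟩ := (hf a).2 ha
    obtain ⟨b, rfl⟩ := (hf b).2 hb
    simpa using hcov (v := a) (w := b) hab
  · rintro ⟨S, hk, hcov, hconn⟩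
    obtain ⟨S, ⟨hcov, hconn⟩, hk, hS⟩ := exists_disjoint_removed (G := G) (c := c) (k := k)
      (P := fun S => G.IsVertexCover (S : Set (Fin n)) ∧ (G.induce (S : Set (Fin n))).Connected)
      (by
        rintro S i j ⟨h₁, h₂⟩ hi hj hij
        have hmem : ∀ v, v ∈ S.map (Equiv.swap i j).toEmbedding ↔ Equiv.swap i j v ∈ S := by
          intro v
          rw [Finset.mem_map_equiv, Equiv.symm_swap]
        refine ⟨fun a b hab => ?_, ?_⟩
        · simp only [Finset.mem_coe, hmem]
          exact h₁ ((hij.adj_swap a b).2 hab)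
        · have e : G.induce (S : Set (Fin n)) ≃g
              G.induce ((S.map (Equiv.swap i j).toEmbedding : Finset (Fin n)) : Set (Fin n)) :=
            ⟨((Equiv.swap i j).image _).trans (Equiv.setCongr (by simp)), fun {a b} =>
              hij.adj_swap a b⟩
          exact e.connected_iff.1 h₂)
      ⟨hcov, hconn⟩ hk
    obtain ⟨S', rfl⟩ : ∃ S' : Finset (Fin m), S'.map f = S := by
      refine ⟨Finset.univ.filter fun i => f i ∈ S, ?_⟩
      ext v
      simp only [Finset.mem_map, Finset.mem_filter, Finset.mem_univ, true_and]
      constructor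
      · rintro ⟨i, hi, rfl⟩
        exact hi
      · intro hv
        obtain ⟨i, rfl⟩ := (hf v).2 (hS v hv)
        exact ⟨i, hv, rfl⟩
    refine ⟨S', by simpa using hk, fun a b hab => ?_, (hiso S').some.connected_iff.2 hconn⟩
    simpa using hcov (v := f a) (w := f b) hab

end

/-! ### Capacitated vertex covers -/

open Classical in
/-- A form of capacitated vertex covers which avoids maps on the edge set: `A v w` means that the
edge `vw` is assigned to `v`. Edges may be assigned to both endpoints. -/
def CapacitatedCover {n : ℕ} (G : SimpleGraph (Fin n)) (c : Fin n → ℕ) (S : Finset (Fin n)) : Prop :=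
  ∃ A : Fin n → Fin n → Prop, (∀ v w, A v w → G.Adj v w ∧ v ∈ S) ∧
    (∀ v w, G.Adj v w → A v w ∨ A w v) ∧
    ∀ v ∈ S, (Finset.univ.filter (A v)).card ≤ c v

section

variable {n : ℕ} {G : SimpleGraph (Fin n)} {c : Fin n → ℕ} {S : Finset (Fin n)}

theorem _root_.isCapacitatedVertexCover_iff :
    IsCapacitatedVertexCover G c S ↔ G.CapacitatedCover c S := by
  classical
  constructor
  · rintro ⟨-, ρ, hρ, hc⟩
    refine ⟨fun v w => ∃ h : G.Adj v w, ρ ⟨s(v, w), h⟩ = v, ?_, ?_, ?_⟩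
    · rintro v w ⟨h, hv⟩
      exact ⟨h, hv ▸ (hρ _).1⟩
    · intro v w h
      rcases Sym2.mem_iff.1 (hρ ⟨s(v, w), h⟩).2 with h' | h'
      · exact Or.inl ⟨h, h'⟩
      · have he : (⟨s(w, v), h.symm⟩ : G.edgeSet) = ⟨s(v, w), h⟩ := Subtype.ext Sym2.eq_swap
        exact Or.inr ⟨h.symm, (congrArg ρ he).trans h'⟩
    · intro v hv
      refine le_trans ?_ (hc v hv)
      rw [← Set.ncard_coe_finset, ← Set.ncard_image_of_injective _ Subtype.val_injective]
      refine Set.ncard_le_ncard_of_injOn (fun w => s(v, w)) ?_ ?_ (Set.toFinite _)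
      · intro w hw
        simp only [Finset.coe_filter, Finset.mem_univ, true_and, Set.mem_ofPred_eq] at hw
        obtain ⟨h, hw⟩ := hw
        exact ⟨⟨s(v, w), h⟩, hw, rfl⟩
      · intro w _ w' _ h
        exact Sym2.congr_right.1 h
  · rintro ⟨A, hA, hcov, hc⟩
    have hex : ∀ e : G.edgeSet, ∃ p : Fin n × Fin n, (e : Sym2 (Fin n)) = s(p.1, p.2) ∧
        A p.1 p.2 := by
      rintro ⟨e, he⟩
      induction e using Sym2.ind with
      | _ v w =>
        rcases hcov v w he with h | h
        · exact ⟨(v, w), rfl, h⟩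
        · exact ⟨(w, v), Sym2.eq_swap, h⟩
    choose p hp hpA using hex
    refine ⟨fun v w h => (hcov v w h).imp (fun h => (hA _ _ h).2) fun h => (hA _ _ h).2,
      fun e => (p e).1, fun e => ⟨(hA _ _ (hpA e)).2, ?_⟩, fun v hv => ?_⟩
    · rw [hp e]
      exact Sym2.mem_mk_left _ _
    · refine le_trans ?_ (hc v hv)
      rw [← Set.ncard_coe_finset]
      refine Set.ncard_le_ncard_of_injOn (fun e => (p e).2) ?_ ?_ (Set.toFinite _)
      · rintro e rfl
        simpa using hpA e
      · intro e he e' he' hee'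
        ext1
        rw [hp e, hp e']
        simp only [Set.mem_ofPred_eq] at he he' hee'
        rw [he, he', hee']

/-- A vertex is assigned at most `n` edges. -/
theorem capacitatedCover_min :
    G.CapacitatedCover (fun v => min (c v) n) S ↔ G.CapacitatedCover c S := by
  classical
  refine exists_congr fun A => and_congr_right fun _ => and_congr_right fun _ =>
    forall₂_congr fun v _ => ?_
  have : (Finset.univ.filter (A v)).card ≤ n := by
    simpa using Finset.card_le_univ (Finset.univ.filter (A v))
  simp only [le_min_iff, this, and_true]

theorem Better.capacitatedCover_map_swap {i j : Fin n} (hij : G.Better c i j)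
    (h : G.CapacitatedCover c S) (hj : j ∉ S) :
    G.CapacitatedCover c (S.map (Equiv.swap i j).toEmbedding) := by
  classical
  obtain ⟨A, hA, hcov, hc⟩ := h
  have hmem : ∀ v, v ∈ S.map (Equiv.swap i j).toEmbedding ↔ Equiv.swap i j v ∈ S := by
    intro v
    rw [Finset.mem_map_equiv, Equiv.symm_swap]
  refine ⟨fun v w => A (Equiv.swap i j v) (Equiv.swap i j w), fun v w h => ?_, fun v w h => ?_,
    fun v hv => ?_⟩
  · rw [hmem, ← hij.adj_swap]
    exact hA _ _ h
  · exact hcov _ _ ((hij.adj_swap v w).2 h)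
  · rw [hmem] at hv
    have hcard : (Finset.univ.filter fun w => A (Equiv.swap i j v) (Equiv.swap i j w)).card =
        (Finset.univ.filter (A (Equiv.swap i j v))).card :=
      Finset.card_equiv (Equiv.swap i j) (by simp)
    rw [hcard]
    refine (hc _ hv).trans ?_
    by_cases hvj : v = j
    · rw [hvj, Equiv.swap_apply_right]
      exact hij.le
    · by_cases hvi : v = i
      · rw [hvi, Equiv.swap_apply_left] at hv
        exact absurd hv hj
      · rw [Equiv.swap_apply_of_ne_of_ne hvi hvj]

open Classical in
/-- The number of removed neighbors of a vertex. -/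
noncomputable def removedDegree (G : SimpleGraph (Fin n)) (c : Fin n → ℕ) (k : ℕ) (v : Fin n) : ℕ :=
  (Finset.univ.filter fun i => i ∈ G.removed c k ∧ G.Adj v i).card

variable {m k : ℕ} {f : Fin m ↪ Fin n}

/-- A capacitated vertex cover without removed vertices contains all neighbors of the removed
vertices, and the edges to the removed vertices are assigned to these neighbors. Hence the capacities
are reduced by the numbers of removed neighbors. -/
theorem capacitatedCover_kept_iff (hf : ∀ v, v ∈ Set.range f ↔ v ∉ G.removed c k) :
    ((∀ v, G.removedDegree c k v ≤ c v) ∧ ∃ S : Finset (Fin m), S.card ≤ k ∧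
      (G.comap f).CapacitatedCover
        (fun i => min (c (f i) - G.removedDegree c k (f i)) m) S) ↔
    ∃ S : Finset (Fin n), S.card ≤ k ∧ G.CapacitatedCover c S := by
  classical
  constructor
  · rintro ⟨hr, S, hk, A, hA, hcov, hc⟩
    have hSR : ∀ v ∈ S.map f, v ∉ G.removed c k := by
      intro v hv
      obtain ⟨i, -, rfl⟩ := Finset.mem_map.1 hv
      exact (hf _).1 ⟨i, rfl⟩
    have hvc : G.IsVertexCover ((S.map f : Finset (Fin n)) : Set (Fin n)) := by
      refine isVertexCover_of_kept (c := c) (k := k) (by simpa using hk) fun a b ha hb hab => ?_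
      obtain ⟨a, rfl⟩ := (hf a).2 ha
      obtain ⟨b, rfl⟩ := (hf b).2 hb
      rcases hcov a b hab with h | h
      · exact Or.inl (by simpa using (hA _ _ h).2)
      · exact Or.inr (by simpa using (hA _ _ h).2)
    refine ⟨S.map f, by simpa using hk, fun v w => (∃ i j, f i = v ∧ f j = w ∧ A i j) ∨
      (w ∈ G.removed c k ∧ G.Adj v w ∧ v ∈ S.map f), ?_, ?_, ?_⟩
    · rintro v w (⟨i, j, rfl, rfl, h⟩ | ⟨-, h₁, h₂⟩)
      · exact ⟨(hA _ _ h).1, Finset.mem_map_of_mem f (hA _ _ h).2⟩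
      · exact ⟨h₁, h₂⟩
    · intro v w h
      by_cases hw : w ∈ G.removed c k
      · exact Or.inl (Or.inr ⟨hw, h, (hvc h).resolve_right fun h' => hSR w h' hw⟩)
      · by_cases hv : v ∈ G.removed c k
        · exact Or.inr (Or.inr ⟨hv, h.symm, (hvc h).resolve_left fun h' => hSR v h' hv⟩)
        · obtain ⟨v, rfl⟩ := (hf v).2 hv
          obtain ⟨w, rfl⟩ := (hf w).2 hw
          exact (hcov v w h).imp (fun h => Or.inl ⟨v, w, rfl, rfl, h⟩)
            fun h => Or.inl ⟨w, v, rfl, rfl, h⟩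
    · intro v hv
      obtain ⟨i, hi, rfl⟩ := Finset.mem_map.1 hv
      have h₁ := hc i hi
      have h₂ : (Finset.univ.filter fun w => (∃ i' j, f i' = f i ∧ f j = w ∧ A i' j) ∨
          (w ∈ G.removed c k ∧ G.Adj (f i) w ∧ f i ∈ S.map f)) ⊆
          ((Finset.univ.filter (A i)).map f) ∪
            (Finset.univ.filter fun w => w ∈ G.removed c k ∧ G.Adj (f i) w) := by
        intro w hw
        simp only [Finset.mem_filter, Finset.mem_univ, true_and, Finset.mem_union,
          Finset.mem_map] at hw ⊢
        rcases hw with ⟨i', j, hi', rfl, h⟩ | ⟨h, h', -⟩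
        · rw [f.injective hi'] at h
          exact Or.inl ⟨j, h, rfl⟩
        · exact Or.inr ⟨h, h'⟩
      have h₃ := (Finset.card_le_card h₂).trans (Finset.card_union_le _ _)
      rw [Finset.card_map] at h₃
      have h₄ := hr (f i)
      simp only [removedDegree, le_min_iff] at h₁ h₄
      refine le_trans (le_of_eq (by congr)) (h₃.trans ?_)
      omega
  · rintro ⟨S, hk, hS⟩
    obtain ⟨S, ⟨A, hA, hcov, hc⟩, hk, hSR⟩ := exists_disjoint_removed (G := G) (c := c) (k := k)
      (P := G.CapacitatedCover c)
      (fun S i j hS _ hj hij => hij.capacitatedCover_map_swap hS hj) hS hk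
    have hAR : ∀ v w, w ∈ G.removed c k → G.Adj v w → A v w := fun v w hw h =>
      (hcov v w h).resolve_right fun h' => hSR w (hA _ _ h').2 hw
    -- the kept and the removed neighbors whose edges are assigned to `v`
    have hsum : ∀ v ∈ S, (Finset.univ.filter fun j => A v (f j)).card + G.removedDegree c k v ≤
        c v := by
      intro v hv
      refine le_trans ?_ (hc v hv)
      rw [← Finset.card_map f, removedDegree, ← Finset.card_union_of_disjoint]
      · refine Finset.card_le_card fun w hw => ?_
        simp only [Finset.mem_filter, Finset.mem_univ, true_and, Finset.mem_union,
          Finset.mem_map] at hw ⊢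
        rcases hw with ⟨j, hj, rfl⟩ | hw
        · exact hj
        · exact hAR v w hw.1 hw.2
      · rw [Finset.disjoint_left]
        intro w hw hw'
        simp only [Finset.mem_filter, Finset.mem_univ, true_and, Finset.mem_map] at hw hw'
        obtain ⟨j, -, rfl⟩ := hw
        exact (hf _).1 ⟨j, rfl⟩ hw'.1
    refine ⟨fun v => ?_, Finset.univ.filter fun i => f i ∈ S, ?_, fun i j => A (f i) (f j),
      fun i j h => ?_, fun i j h => hcov _ _ h, fun i hi => ?_⟩
    · rcases Nat.eq_zero_or_pos (G.removedDegree c k v) with h | h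
      · omega
      · obtain ⟨w, hw⟩ := Finset.card_pos.1 h
        simp only [Finset.mem_filter, Finset.mem_univ, true_and] at hw
        have := hsum v (hA _ _ (hAR v w hw.1 hw.2)).2
        omega
    · refine le_trans ?_ hk
      rw [← Finset.card_map f]
      refine Finset.card_le_card fun v hv => ?_
      simp only [Finset.mem_filter, Finset.mem_univ, true_and, Finset.mem_map] at hv
      obtain ⟨i, hi, rfl⟩ := hv
      exact hi
    · simpa using hA _ _ h
    · have h₁ := hsum (f i) (by simpa using hi)
      have h₂ : (Finset.univ.filter fun j => A (f i) (f j)).card ≤ m := by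
        simpa using Finset.card_le_univ (Finset.univ.filter fun j => A (f i) (f j))
      simp only [le_min_iff]
      exact ⟨by omega, h₂⟩

end

end SimpleGraph

/-! ### The reduction rule on encoded instances -/

theorem card_filter_range_eq {n : ℕ} {P : ℕ → Prop} {Q : Fin n → Prop} [DecidablePred P]
    [DecidablePred Q] (h : ∀ i : Fin n, P i ↔ Q i) :
    ((Finset.range n).filter P).card = (Finset.univ.filter Q).card := by
  rw [Finset.card_filter, Finset.card_filter, ← Fin.sum_univ_eq_sum_range]
  exact Finset.sum_congr rfl fun i _ => by simp only [h]

/-- Functions which read an annotated graph and a bound from a word, given as a list of blocks. -/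
structure Reader where
  n : List (List Bool) → ℕ
  adj : List (List Bool) → ℕ → ℕ → Prop
  cap : List (List Bool) → ℕ → ℕ
  bound : List (List Bool) → ℕ

namespace Reader

/-- The functions of the reader are computed in polynomial time, in every context. -/
structure Poly (R : Reader) : Prop where
  n : ∀ {Y : Type} [Ctx Y], PolyNat fun y : Y => R.n (Ctx.word y)
  adj : ∀ {Y : Type} [Ctx Y] {g h : Y → ℕ}, PolyNat g → PolyNat h →
    PolyPred fun y : Y => R.adj (Ctx.word y) (g y) (h y)
  cap : ∀ {Y : Type} [Ctx Y] {g : Y → ℕ}, PolyNat g →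
    PolyNat fun y : Y => R.cap (Ctx.word y) (g y)
  bound : ∀ {Y : Type} [Ctx Y], PolyNat fun y : Y => R.bound (Ctx.word y)

/-- The reader finds the graph `G`, the capacities `c` and the bound `min k n` in the word `L`. -/
structure Reads (R : Reader) (L : List (List Bool)) {n : ℕ} (G : SimpleGraph (Fin n))
    (c : Fin n → ℕ) (k : ℕ) : Prop where
  n_eq : R.n L = n
  adj : ∀ i j : Fin n, R.adj L i j ↔ G.Adj i j
  cap : ∀ i : Fin n, R.cap L i = c i
  bound : R.bound L = min k n

variable (R : Reader) (L : List (List Bool))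

/-- `SimpleGraph.Better`, read from a word. -/
def Better (i j : ℕ) : Prop :=
  (∀ l < R.n L, (R.adj L i l ↔ R.adj L j l)) ∧
    (R.cap L i < R.cap L j ∨ R.cap L i = R.cap L j ∧ i < j)

open Classical in
/-- `SimpleGraph.removed`, read from a word. -/
def Removed (i : ℕ) : Prop :=
  R.bound L < ((Finset.range (R.n L)).filter fun j => R.Better L i j).card

open Classical in
/-- The number of kept vertices. -/
noncomputable def numKept : ℕ := ((Finset.range (R.n L)).filter fun i => ¬R.Removed L i).card

open Classical in
/-- `SimpleGraph.removedDegree`, read from a word. -/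
noncomputable def removedDegree (v : ℕ) : ℕ :=
  ((Finset.range (R.n L)).filter fun i => R.Removed L i ∧ R.adj L v i).card

open Classical in
/-- The row of the vertex `i` in the adjacency matrix, restricted to the kept vertices. -/
noncomputable def row (i : ℕ) : List (Option Bool) :=
  (List.range (R.n L)).flatMap fun j =>
    if R.Removed L j then [] else if R.adj L i j then [some true] else [some false]

/-- There are too many kept vertices for a yes-instance. That the bound is only known up to its
minimum with the number of vertices makes no difference, see `Reader.Reads.large_iff`. -/
def Large (C : ℕ) : Prop := C * (R.bound L * R.bound L + 1) < R.numKept L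

variable {R L}

section

variable (hR : R.Poly) {Y : Type} [Ctx Y] {g h : Y → ℕ}
include hR

theorem Poly.better (hg : PolyNat g) (hh : PolyNat h) :
    PolyPred fun y : Y => R.Better (Ctx.word y) (g y) (h y) :=
  (PolyPred.forall_lt hR.n
    (P := fun y l => R.adj (Ctx.word y) (g y) l ↔ R.adj (Ctx.word y) (h y) l)
    (PolyPred.iff (hR.adj hg.weaken PolyNat.var) (hR.adj hh.weaken PolyNat.var))).and
    ((PolyPred.lt (hR.cap hg) (hR.cap hh)).or
      ((PolyPred.eq (hR.cap hg) (hR.cap hh)).and (PolyPred.lt hg hh)))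

theorem Poly.removed (hg : PolyNat g) : PolyPred fun y : Y => R.Removed (Ctx.word y) (g y) := by
  classical
  exact PolyPred.lt hR.bound (PolyNat.card_filter hR.n
    (P := fun y j => R.Better (Ctx.word y) (g y) j) (hR.better hg.weaken PolyNat.var))

theorem Poly.numKept : PolyNat fun y : Y => R.numKept (Ctx.word y) := by
  classical
  exact PolyNat.card_filter hR.n (P := fun y i => ¬R.Removed (Ctx.word y) i)
    (hR.removed (Y := Y × ℕ) PolyNat.var).not

theorem Poly.removedDegree (hg : PolyNat g) :
    PolyNat fun y : Y => R.removedDegree (Ctx.word y) (g y) := by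
  classical
  exact PolyNat.card_filter hR.n
    (P := fun y i => R.Removed (Ctx.word y) i ∧ R.adj (Ctx.word y) (g y) i)
    ((hR.removed (Y := Y × ℕ) PolyNat.var).and (hR.adj hg.weaken PolyNat.var))

theorem Poly.row (hg : PolyNat g) : PolyWord fun y : Y => R.row (Ctx.word y) (g y) := by
  classical
  exact PolyWord.flatMap hR.n (g := fun y j => if R.Removed (Ctx.word y) j then [] else
      if R.adj (Ctx.word y) (g y) j then [some true] else [some false])
    (PolyWord.ite (hR.removed (Y := Y × ℕ) PolyNat.var) PolyWord.nil
      (PolyWord.ite (hR.adj hg.weaken PolyNat.var) (PolyWord.const _) (PolyWord.const _)))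

theorem Poly.large (C : ℕ) : PolyPred fun y : Y => R.Large (Ctx.word y) C :=
  PolyPred.lt ((PolyNat.const C).mul (hR.bound.mul hR.bound).succ) hR.numKept

end

end Reader

/-- The kept vertices, in increasing order. -/
noncomputable def SimpleGraph.keptList {n : ℕ} (G : SimpleGraph (Fin n)) (c : Fin n → ℕ) (k : ℕ) :
    List (Fin n) :=
  (List.finRange n).filter fun i => i ∉ G.removed c k

/-- The embedding of the kernel into the graph. -/
noncomputable def SimpleGraph.keptEmbedding {n : ℕ} (G : SimpleGraph (Fin n)) (c : Fin n → ℕ)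
    (k : ℕ) : Fin (G.keptList c k).length ↪ Fin n :=
  ⟨(G.keptList c k).get, List.nodup_iff_injective_get.1 ((List.nodup_finRange n).filter _)⟩

theorem SimpleGraph.mem_range_keptEmbedding {n : ℕ} (G : SimpleGraph (Fin n)) (c : Fin n → ℕ)
    (k : ℕ) (v : Fin n) : v ∈ Set.range (G.keptEmbedding c k) ↔ v ∉ G.removed c k := by
  have h : v ∈ Set.range (G.keptEmbedding c k) ↔ v ∈ G.keptList c k := List.mem_iff_get.symm
  rw [h]
  simp [SimpleGraph.keptList]

theorem SimpleGraph.length_keptList {n : ℕ} (G : SimpleGraph (Fin n)) (c : Fin n → ℕ) (k : ℕ) :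
    (G.keptList c k).length = (Finset.univ.filter fun v => v ∉ G.removed c k).card := by
  rw [SimpleGraph.keptList, ← List.toFinset_card_of_nodup ((List.nodup_finRange n).filter _)]
  congr 1
  ext v
  simp

theorem SimpleGraph.adjRow_comap_keptEmbedding {n : ℕ} (G : SimpleGraph (Fin n)) (c : Fin n → ℕ)
    (k : ℕ) (i : Fin (G.keptList c k).length) :
    open Classical in adjRow (G.comap (G.keptEmbedding c k)) i =
      (G.keptList c k).map fun v => decide (G.Adj (G.keptEmbedding c k i) v) := by
  classical
  have h : ∀ (l : List (Fin n)) (p : Fin n → Bool), l.map p = List.ofFn fun j => p (l.get j) := by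
    intro l p
    conv_lhs => rw [← List.ofFn_get l, List.map_ofFn]
    rfl
  exact (h (G.keptList c k) fun v => decide (G.Adj (G.keptEmbedding c k i) v)).symm

theorem List.flatMap_filter_eq {α β : Type} (l : List α) (p : α → Bool) (g : α → List β) :
    (l.filter p).flatMap g = l.flatMap fun a => if p a then g a else [] := by
  induction l with
  | nil => rfl
  | cons a l ih =>
    rw [List.filter_cons, List.flatMap_cons]
    split_ifs <;> simp [ih]

theorem List.flatMap_range_eq_finRange {β : Type} (n : ℕ) (g : ℕ → List β) :
    (List.range n).flatMap g = (List.finRange n).flatMap fun i : Fin n => g i := by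
  rw [← List.map_coe_finRange_eq_range, List.flatMap_map]

namespace Reader.Reads

variable {R : Reader} {L : List (List Bool)} {n : ℕ} {G : SimpleGraph (Fin n)} {c : Fin n → ℕ}
  {k : ℕ} (h : R.Reads L G c k)
include h

theorem better_iff (i j : Fin n) : R.Better L i j ↔ G.Better c i j := by
  unfold Reader.Better SimpleGraph.Better
  rw [h.n_eq, h.cap, h.cap, ← Fin.lt_def]
  refine and_congr_left fun _ => ?_
  simp only [← h.adj]
  exact ⟨fun H l => H l l.2, fun H l hl => H ⟨l, hl⟩⟩

theorem removed_iff (i : Fin n) : R.Removed L i ↔ i ∈ G.removed c k := by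
  classical
  rw [← SimpleGraph.removed_min, Reader.Removed, h.bound, h.n_eq,
    card_filter_range_eq (h.better_iff i)]
  simp [SimpleGraph.removed]

theorem numKept_eq : R.numKept L = (G.keptList c k).length := by
  classical
  rw [Reader.numKept, h.n_eq, G.length_keptList,
    card_filter_range_eq fun i => not_congr (h.removed_iff i)]

theorem removedDegree_eq (v : Fin n) : R.removedDegree L v = G.removedDegree c k v := by
  classical
  rw [Reader.removedDegree, h.n_eq, SimpleGraph.removedDegree,
    card_filter_range_eq fun i => and_congr (h.removed_iff i) (h.adj v i)]

theorem large_iff {C : ℕ} (hC : 0 < C) :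
    R.Large L C ↔ C * (k ^ 2 + 1) < (G.keptList c k).length := by
  rw [Reader.Large, h.bound, h.numKept_eq, ← pow_two]
  rcases le_total k n with hk | hk
  · rw [min_eq_left hk]
  · have hlen : (G.keptList c k).length ≤ n := by
      simpa [SimpleGraph.keptList] using
        List.length_filter_le (fun i => decide (i ∉ G.removed c k)) (List.finRange n)
    have key : ∀ m, n ≤ m → n ≤ C * (m ^ 2 + 1) := fun m hm =>
      hm.trans ((Nat.le_self_pow two_ne_zero m).trans
        ((Nat.le_succ _).trans (Nat.le_mul_of_pos_left _ hC)))
    rw [min_eq_right hk]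
    have h₁ := key n le_rfl
    have h₂ := key k hk
    omega

theorem flatMap_kept {g : ℕ → List (Option Bool)} {g' : Fin n → List (Option Bool)}
    (hg : ∀ i : Fin n, g i = g' i) :
    open Classical in (List.range (R.n L)).flatMap (fun i => if R.Removed L i then [] else g i) =
      (G.keptList c k).flatMap g' := by
  classical
  rw [h.n_eq, List.flatMap_range_eq_finRange, SimpleGraph.keptList, List.flatMap_filter_eq]
  congr 1
  funext i
  by_cases hi : i ∈ G.removed c k <;> simp [hi, h.removed_iff, hg]

theorem row_eq (i : Fin (G.keptList c k).length) :
    R.row L (G.keptEmbedding c k i) =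
      (adjRow (G.comap (G.keptEmbedding c k)) i).map some := by
  classical
  rw [G.adjRow_comap_keptEmbedding, List.map_map, List.map_eq_flatMap]
  refine h.flatMap_kept fun j => ?_
  by_cases hj : G.Adj (G.keptEmbedding c k i) j <;> simp [h.adj, hj]

end Reader.Reads

/-! ### Lengths and entries of encodings -/

theorem List.flatMap_finRange_get {α β : Type} (l : List α) (g : α → List β) :
    (List.finRange l.length).flatMap (fun i => g (l.get i)) = l.flatMap g := by
  have h := List.flatMap_map l.get g (List.finRange l.length)
  rw [List.map_get_finRange] at h
  exact h.symm

theorem getElem?_flatMap_pair {α β : Type} (l : List α) (f g : α → β) (i : ℕ) :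
    (l.flatMap fun a => [f a, g a])[2 * i]? = l[i]?.map f ∧
      (l.flatMap fun a => [f a, g a])[2 * i + 1]? = l[i]?.map g := by
  induction l generalizing i with
  | nil => simp
  | cons a l ih =>
    rw [List.flatMap_cons]
    cases i with
    | zero => simp
    | succ i =>
      have h := ih i
      simpa [Nat.mul_add] using h

theorem length_encodeBlocks_le {L : List (List Bool)} {B : ℕ} (h : ∀ b ∈ L, b.length ≤ B) :
    (encodeBlocks L).length ≤ L.length * (B + 1) := by
  induction L with
  | nil => simp [encodeBlocks]
  | cons b L ih =>
    rw [encodeBlocks_cons, List.length_append, List.length_map, List.length_cons, List.length_cons,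
      Nat.add_mul]
    have h₁ := h b List.mem_cons_self
    have h₂ := ih fun b hb => h b (List.mem_cons_of_mem _ hb)
    omega

theorem length_encodeNat_le (n : ℕ) : (Computability.encodeNat n).length ≤ n := by
  rw [length_encodeNat]
  exact Nat.size_le.2 Nat.lt_two_pow_self

theorem length_adjRow {n : ℕ} (G : SimpleGraph (Fin n)) (i : Fin n) :
    (adjRow G i).length = n := by
  simp [adjRow]

theorem getElem?_adjRow_eq_some_true {n : ℕ} (G : SimpleGraph (Fin n)) (i j : Fin n) :
    (adjRow G i)[(j : ℕ)]? = some true ↔ G.Adj i j := by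
  simp [adjRow]

/-- On a yes-instance, the number of kept vertices is quadratic in the parameter. -/
theorem FinGraph.TwinWidthLE.length_keptList_le {G : FinGraph} {d k : ℕ} (h : G.TwinWidthLE d)
    (c : Fin G.n → ℕ) {S : Finset (Fin G.n)} (hS : G.graph.IsVertexCover (S : Set (Fin G.n)))
    (hk : S.card ≤ k) :
    (G.graph.keptList c k).length ≤ (2 * ((d + 1) * 2 ^ (2 * (d + 1))) + 5) * (k ^ 2 + 1) := by
  rw [G.graph.length_keptList]
  refine h.card_le_of_isVertexCover hS hk fun v => ?_
  exact SimpleGraph.card_kept_twins_le v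

/-! ### The kernel of Connected Vertex Cover -/

namespace ConnectedVCInstance

noncomputable instance : Ctx ConnectedVCInstance where
  word x := Computability.encodeNat x.k :: List.ofFn fun i => adjRow x.G.graph i
  env _ := []

/-- Reads the graph of an instance; all capacities are set to `0`. -/
noncomputable def reader : Reader where
  n L := (L[1]?.getD []).length
  adj L i j := blockDigit L (i + 1) j = 2
  cap _ _ := 0
  bound L := min (blockValue L 0) (L[1]?.getD []).length

theorem reader_poly : reader.Poly where
  n := PolyNat.length_block (PolyNat.const 1)
  adj hg hh := PolyPred.eq (hg.succ.digit hh) (PolyNat.const 2)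
  cap _ := PolyNat.const 0
  bound := PolyNat.min_blockValue (PolyNat.const 0) (PolyNat.length_block (PolyNat.const 1))

theorem reads (x : ConnectedVCInstance) :
    reader.Reads (Ctx.word x) x.G.graph (fun _ => 0) x.k := by
  obtain ⟨⟨n, G⟩, k⟩ := x
  have hn : ((Ctx.word (⟨⟨n, G⟩, k⟩ : ConnectedVCInstance))[1]?.getD []).length = n := by
    simp only [Ctx.word, List.getElem?_cons_succ, List.getElem?_ofFn]
    split_ifs with h
    · simp [length_adjRow]
    · simp
      omega
  refine ⟨hn, fun i j => ?_, fun _ => rfl, ?_⟩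
  · simp only [reader, blockDigit_eq_two_iff, Ctx.word, List.getElem?_cons_succ, List.getElem?_ofFn,
      i.2, dite_true, Option.getD_some]
    exact getElem?_adjRow_eq_some_true G i j
  · simp only [reader, hn]
    rw [blockValue_eq (c := k) rfl]

/-- The kernelization: a trivial no-instance if too many vertices are kept, and otherwise the graph
induced by the kept vertices. -/
noncomputable def kernel (C : ℕ) (x : ConnectedVCInstance) : ConnectedVCInstance :=
  if C * (x.k ^ 2 + 1) < (x.G.graph.keptList (fun _ => 0) x.k).length then ⟨⟨0, ⊥⟩, 0⟩
  else ⟨⟨_, x.G.graph.comap (x.G.graph.keptEmbedding (fun _ => 0) x.k)⟩, x.k⟩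

theorem polyWord_kernel {C : ℕ} (hC : 0 < C) :
    PolyWord fun x : ConnectedVCInstance => encodeBlocks (Ctx.word (kernel C x)) := by
  classical
  refine (PolyWord.ite (reader_poly.large C)
    (PolyWord.const (encodeBlocks (Ctx.word (⟨⟨0, ⊥⟩, 0⟩ : ConnectedVCInstance))))
    ((PolyWord.block (PolyNat.const 0)).append ((PolyWord.const [none]).append
      (PolyWord.flatMap reader_poly.n (g := fun x i => if reader.Removed (Ctx.word x) i then [] else
        reader.row (Ctx.word x) i ++ [none]) (PolyWord.ite
          (reader_poly.removed (Y := ConnectedVCInstance × ℕ) PolyNat.var) PolyWord.nil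
          ((reader_poly.row (Y := ConnectedVCInstance × ℕ) PolyNat.var).append
            (PolyWord.const _))))))).congr fun x => ?_
  have hx := x.reads
  unfold kernel
  simp only [hx.large_iff hC]
  split_ifs with h
  · rfl
  · rw [hx.flatMap_kept (fun _ => rfl)]
    conv_rhs => simp only [Ctx.word]
    rw [encodeBlocks_cons]
    congr 1
    rw [List.singleton_append]
    congr 1
    rw [← List.flatMap_finRange_get, encodeBlocks, List.ofFn_eq_map, List.flatMap_map]
    congr 1
    funext i
    rw [← hx.row_eq i]
    rfl

theorem not_yes_of_large {d : ℕ} {x : ConnectedVCInstance} (hx : x.G.TwinWidthLE d)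
    (h : (2 * ((d + 1) * 2 ^ (2 * (d + 1))) + 5) * (x.k ^ 2 + 1) <
      (x.G.graph.keptList (fun _ => 0) x.k).length) : ¬x.Yes := by
  rintro ⟨S, hk, hS, -⟩
  exact absurd (hx.length_keptList_le _ hS hk) (not_le.2 h)

theorem isKernel_kernel {𝒞 : Set FinGraph} {d : ℕ} (hd : ∀ G ∈ 𝒞, G.TwinWidthLE d) :
    connectedVertexCover.IsKernel 𝒞
      (fun k => (2 * ((d + 1) * 2 ^ (2 * (d + 1))) + 5) * (k ^ 2 + 1))
      (kernel (2 * ((d + 1) * 2 ^ (2 * (d + 1))) + 5)) where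
  polytime := PolyWord.nonempty_tm2ComputableInPolyTime (fun _ => rfl)
    (polyWord_kernel (Nat.succ_pos _))
  equivalent := by
    intro x hx
    change (kernel _ x).Yes ↔ x.Yes
    unfold kernel
    split_ifs with h
    · refine iff_of_false ?_ (not_yes_of_large (hd _ hx) h)
      rintro ⟨S, hk, -, hS⟩
      exact hS.nonempty.elim fun v => v.1.elim0
    · exact SimpleGraph.connectedVertexCover_kept_iff (x.G.graph.mem_range_keptEmbedding _ _)
  param_le := by
    intro x _
    change (kernel _ x).k ≤ x.k
    unfold kernel
    split_ifs
    · exact Nat.zero_le _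
    · exact le_rfl
  vertices_le := by
    intro x _
    change (kernel _ x).G.n ≤ (2 * ((d + 1) * 2 ^ (2 * (d + 1))) + 5) * (x.k ^ 2 + 1)
    unfold kernel
    split_ifs with h
    · exact Nat.zero_le _
    · exact not_lt.1 h
  size_le := by
    set C := 2 * ((d + 1) * 2 ^ (2 * (d + 1))) + 5
    let q : Polynomial ℕ := Polynomial.C C * (Polynomial.X ^ 2 + 1)
    refine ⟨Polynomial.X + 1 + q * (q + 1) +
      Polynomial.C (encodeBlocks (Ctx.word (⟨⟨0, ⊥⟩, 0⟩ : ConnectedVCInstance))).length, ?_⟩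
    intro x _
    change (encodeBlocks (Ctx.word (kernel C x))).length ≤ Polynomial.eval x.k _
    have hq : q.eval x.k = C * (x.k ^ 2 + 1) := by simp [q]
    simp only [Polynomial.eval_add, Polynomial.eval_mul, Polynomial.eval_X, Polynomial.eval_one,
      Polynomial.eval_C, hq]
    unfold kernel
    split_ifs with h
    · exact Nat.le_add_left _ _
    · rw [not_lt] at h
      simp only [Ctx.word]
      rw [encodeBlocks_cons, List.length_append, List.length_map, List.length_cons]
      have h₁ := length_encodeNat_le x.k
      have h₂ := length_encodeBlocks_le (L := List.ofFn fun i =>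
        adjRow (x.G.graph.comap (x.G.graph.keptEmbedding (fun _ => 0) x.k)) i)
        (B := (x.G.graph.keptList (fun _ => 0) x.k).length) (by
          intro b hb
          obtain ⟨i, rfl⟩ := List.mem_ofFn.1 hb
          exact (length_adjRow _ _).le)
      rw [List.length_ofFn] at h₂
      have h₃ := h₂.trans (Nat.mul_le_mul h (Nat.succ_le_succ h))
      simp only [Nat.succ_eq_add_one] at h₃
      omega
  induced := by
    intro x _
    change Nonempty ((kernel _ x).G.graph ↪g x.G.graph)
    by_cases h : (2 * ((d + 1) * 2 ^ (2 * (d + 1))) + 5) * (x.k ^ 2 + 1) <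
      (x.G.graph.keptList (fun _ => 0) x.k).length
    · rw [show kernel _ x = _ from if_pos h]
      exact ⟨⟨⟨fun v => v.elim0, fun v => v.elim0⟩, fun {v} => v.elim0⟩⟩
    · rw [show kernel _ x = _ from if_neg h]
      exact ⟨SimpleGraph.Embedding.comap _ _⟩

end ConnectedVCInstance

/-! ### The kernel of Capacitated Vertex Cover -/

namespace CapacitatedVCInstance

noncomputable instance : Ctx CapacitatedVCInstance where
  word x := Computability.encodeNat x.k :: (List.finRange x.G.n).flatMap fun i =>
    [Computability.encodeNat (x.c i), adjRow x.G.graph i]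
  env _ := []

/-- Reads the graph of an instance, and the capacities truncated to the number of vertices. -/
noncomputable def reader : Reader where
  n L := (L[2]?.getD []).length
  adj L i j := blockDigit L (2 * i + 2) j = 2
  cap L i := min (blockValue L (2 * i + 1)) (L[2]?.getD []).length
  bound L := min (blockValue L 0) (L[2]?.getD []).length

theorem reader_poly : reader.Poly where
  n := PolyNat.length_block (PolyNat.const 2)
  adj hg hh := PolyPred.eq ((((PolyNat.const 2).mul hg).add (PolyNat.const 2)).digit hh)
    (PolyNat.const 2)
  cap hg := PolyNat.min_blockValue (((PolyNat.const 2).mul hg).add (PolyNat.const 1))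
    (PolyNat.length_block (PolyNat.const 2))
  bound := PolyNat.min_blockValue (PolyNat.const 0) (PolyNat.length_block (PolyNat.const 2))

/-- The capacities may be truncated since no vertex has more than `n` neighbors. -/
def cap (x : CapacitatedVCInstance) (v : Fin x.G.n) : ℕ := min (x.c v) x.G.n

theorem reads (x : CapacitatedVCInstance) :
    reader.Reads (Ctx.word x) x.G.graph x.cap x.k := by
  obtain ⟨⟨n, G⟩, c, k⟩ := x
  have hrow : ∀ i, (Ctx.word (⟨⟨n, G⟩, c, k⟩ : CapacitatedVCInstance))[2 * i + 2]? =
      (List.finRange n)[i]?.map (adjRow G) := fun i =>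
    (getElem?_flatMap_pair (List.finRange n) (fun i => Computability.encodeNat (c i)) _ i).2
  have hcap : ∀ i, (Ctx.word (⟨⟨n, G⟩, c, k⟩ : CapacitatedVCInstance))[2 * i + 1]? =
      (List.finRange n)[i]?.map fun i => Computability.encodeNat (c i) := fun i =>
    (getElem?_flatMap_pair (List.finRange n) _ (adjRow G) i).1
  have hn : ((Ctx.word (⟨⟨n, G⟩, c, k⟩ : CapacitatedVCInstance))[2]?.getD []).length = n := by
    rw [hrow 0]
    rcases Nat.eq_zero_or_pos n with rfl | h
    · simp
    · simp [h, length_adjRow]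
  refine ⟨hn, fun i j => ?_, fun i => ?_, ?_⟩
  · simp only [reader, blockDigit_eq_two_iff, hrow]
    simpa using getElem?_adjRow_eq_some_true G i j
  · simp only [reader, hn, cap]
    rw [blockValue_eq (c := c i) (by rw [hcap]; simp)]
  · simp only [reader, hn]
    rw [blockValue_eq (c := k) rfl]

/-- A no-instance, given by an edge whose endpoints have capacity `0`. -/
def trivialNo : CapacitatedVCInstance := ⟨⟨2, ⊤⟩, fun _ => 0, 0⟩

/-- The capacity that is left for the edges between kept vertices. -/
noncomputable def newCap (x : CapacitatedVCInstance) (v : Fin x.G.n) : ℕ :=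
  min (x.cap v - x.G.graph.removedDegree x.cap x.k v) (x.G.graph.keptList x.cap x.k).length

/-- The instance is rejected if some vertex cannot cover the edges to its removed neighbors, or if
too many vertices are kept. -/
def Rejected (C : ℕ) (x : CapacitatedVCInstance) : Prop :=
  (∃ v, x.cap v < x.G.graph.removedDegree x.cap x.k v) ∨
    C * (x.k ^ 2 + 1) < (x.G.graph.keptList x.cap x.k).length

open Classical in
/-- The kernelization: a trivial no-instance if the instance is rejected, and otherwise the graph
induced by the kept vertices, with the remaining capacities. -/
noncomputable def kernel (C : ℕ) (x : CapacitatedVCInstance) : CapacitatedVCInstance :=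
  if x.Rejected C then trivialNo
  else ⟨⟨_, x.G.graph.comap (x.G.graph.keptEmbedding x.cap x.k)⟩,
    fun i => x.newCap (x.G.graph.keptEmbedding x.cap x.k i), x.k⟩

theorem polyWord_kernel {C : ℕ} (hC : 0 < C) :
    PolyWord fun x : CapacitatedVCInstance => encodeBlocks (Ctx.word (kernel C x)) := by
  classical
  have hvar := PolyNat.var (X := CapacitatedVCInstance)
  have hdeg : PolyNat fun x : CapacitatedVCInstance × ℕ =>
      reader.removedDegree (Ctx.word x.1) x.2 := reader_poly.removedDegree hvar
  have hcap : PolyNat fun x : CapacitatedVCInstance × ℕ => reader.cap (Ctx.word x.1) x.2 :=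
    reader_poly.cap hvar
  have hkept : PolyNat fun x : CapacitatedVCInstance × ℕ => reader.numKept (Ctx.word x.1) :=
    PolyNat.weaken reader_poly.numKept
  refine (PolyWord.ite ((PolyPred.exists_lt reader_poly.n
      (P := fun x v => reader.cap (Ctx.word x) v < reader.removedDegree (Ctx.word x) v)
      (PolyPred.lt hcap hdeg)).or (reader_poly.large C))
    (PolyWord.const (encodeBlocks (Ctx.word trivialNo)))
    ((PolyWord.block (PolyNat.const 0)).append ((PolyWord.const [none]).append
      (PolyWord.flatMap reader_poly.n (g := fun x i => if reader.Removed (Ctx.word x) i then [] else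
        (Computability.encodeNat (min (reader.cap (Ctx.word x) i -
          reader.removedDegree (Ctx.word x) i) (reader.numKept (Ctx.word x)))).map some ++
            ([none] ++ (reader.row (Ctx.word x) i ++ [none]))) (PolyWord.ite
          (reader_poly.removed hvar) PolyWord.nil
          ((PolyWord.encodeNat ((hcap.sub hdeg).min hkept)).append
            ((PolyWord.const _).append ((reader_poly.row hvar).append
              (PolyWord.const _))))))))).congr fun x => ?_
  have hx := x.reads
  have hrej : ((∃ v < reader.n (Ctx.word x), reader.cap (Ctx.word x) v <
      reader.removedDegree (Ctx.word x) v) ∨ reader.Large (Ctx.word x) C) ↔ x.Rejected C := by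
    rw [hx.large_iff hC, hx.n_eq, Rejected]
    refine or_congr_left ⟨fun ⟨v, hv, h⟩ => ⟨⟨v, hv⟩, ?_⟩, fun ⟨v, h⟩ => ⟨v, v.2, ?_⟩⟩
    · rwa [← hx.cap, ← hx.removedDegree_eq]
    · rwa [hx.cap, hx.removedDegree_eq]
  unfold kernel
  simp only [hrej]
  split_ifs with h
  · rfl
  · rw [hx.flatMap_kept (fun _ => rfl)]
    conv_rhs => simp only [Ctx.word]
    rw [encodeBlocks_cons]
    congr 1
    rw [List.singleton_append]
    congr 1
    rw [← List.flatMap_finRange_get, encodeBlocks, List.flatMap_assoc]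
    congr 1
    funext i
    have h₁ := hx.row_eq i
    have h₂ := hx.cap (x.G.graph.keptEmbedding x.cap x.k i)
    have h₃ := hx.removedDegree_eq (x.G.graph.keptEmbedding x.cap x.k i)
    have h₄ := hx.numKept_eq
    change (Computability.encodeNat (min (reader.cap (Ctx.word x)
      (x.G.graph.keptEmbedding x.cap x.k i) - reader.removedDegree (Ctx.word x)
      (x.G.graph.keptEmbedding x.cap x.k i)) (reader.numKept (Ctx.word x)))).map some ++
      ([none] ++ (reader.row (Ctx.word x) (x.G.graph.keptEmbedding x.cap x.k i) ++ [none])) = _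
    rw [h₁, h₂, h₃, h₄]
    simp [newCap]

theorem yes_iff (x : CapacitatedVCInstance) :
    x.Yes ↔ ∃ S : Finset (Fin x.G.n), S.card ≤ x.k ∧ x.G.graph.CapacitatedCover x.cap S := by
  refine exists_congr fun S => and_congr_right fun _ => ?_
  rw [isCapacitatedVertexCover_iff]
  exact SimpleGraph.capacitatedCover_min.symm

theorem not_yes_of_rejected {d : ℕ} {x : CapacitatedVCInstance} (hx : x.G.TwinWidthLE d)
    (h : x.Rejected (2 * ((d + 1) * 2 ^ (2 * (d + 1))) + 5)) : ¬x.Yes := by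
  intro hy
  rcases h with ⟨v, hv⟩ | h
  · have := (SimpleGraph.capacitatedCover_kept_iff
      (x.G.graph.mem_range_keptEmbedding x.cap x.k)).2 (x.yes_iff.1 hy)
    exact absurd (this.1 v) (not_le.2 hv)
  · obtain ⟨S, hk, hS, -⟩ := hy
    exact absurd (hx.length_keptList_le _ hS hk) (not_le.2 h)

theorem not_yes_trivialNo : ¬trivialNo.Yes := by
  rintro ⟨S, hk, hS, -⟩
  obtain rfl : S = ∅ := Finset.card_eq_zero.1 (Nat.le_zero.1 hk)
  have h : (⊤ : SimpleGraph (Fin 2)).Adj 0 1 := by simp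
  rcases hS h with h | h <;> exact absurd (Finset.mem_coe.1 h) (Finset.notMem_empty _)

/-- A no-instance has an edge, which is an induced copy of the graph of `trivialNo`. -/
theorem nonempty_embedding_of_not_yes {x : CapacitatedVCInstance} (h : ¬x.Yes) :
    Nonempty ((⊤ : SimpleGraph (Fin 2)) ↪g x.G.graph) := by
  have hex : ∃ u v, x.G.graph.Adj u v := by
    by_contra! hno
    exact h (x.yes_iff.2 ⟨∅, by simp, fun _ _ => False, by simp,
      fun u v huv => absurd huv (hno u v), by simp⟩)
  obtain ⟨u, v, huv⟩ := hex
  refine ⟨⟨⟨![u, v], ?_⟩, ?_⟩⟩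
  · intro a b hab
    fin_cases a <;> fin_cases b <;> simp_all [huv.ne, huv.ne']
  · intro a b
    change x.G.graph.Adj (![u, v] a) (![u, v] b) ↔ _
    fin_cases a <;> fin_cases b <;> simp [huv, huv.symm]

theorem isKernel_kernel {𝒞 : Set FinGraph} {d : ℕ} (hd : ∀ G ∈ 𝒞, G.TwinWidthLE d) :
    capacitatedVertexCover.IsKernel 𝒞
      (fun k => (2 * ((d + 1) * 2 ^ (2 * (d + 1))) + 5) * (k ^ 2 + 1))
      (kernel (2 * ((d + 1) * 2 ^ (2 * (d + 1))) + 5)) where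
  polytime := PolyWord.nonempty_tm2ComputableInPolyTime (fun _ => rfl)
    (polyWord_kernel (Nat.succ_pos _))
  equivalent := by
    intro x hx
    change (kernel _ x).Yes ↔ x.Yes
    unfold kernel
    split_ifs with h
    · exact iff_of_false not_yes_trivialNo (not_yes_of_rejected (hd _ hx) h)
    · rw [x.yes_iff, ← SimpleGraph.capacitatedCover_kept_iff
        (x.G.graph.mem_range_keptEmbedding x.cap x.k)]
      simp only [Rejected, not_or, not_exists, not_lt] at h
      rw [and_iff_right h.1]
      exact exists_congr fun S => and_congr_right fun _ => isCapacitatedVertexCover_iff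
  param_le := by
    intro x _
    change (kernel _ x).k ≤ x.k
    unfold kernel
    split_ifs
    · exact Nat.zero_le _
    · exact le_rfl
  vertices_le := by
    intro x _
    change (kernel _ x).G.n ≤ (2 * ((d + 1) * 2 ^ (2 * (d + 1))) + 5) * (x.k ^ 2 + 1)
    unfold kernel
    split_ifs with h
    · change 2 ≤ _
      nlinarith [Nat.zero_le (x.k ^ 2), Nat.zero_le ((d + 1) * 2 ^ (2 * (d + 1))),
        Nat.zero_le ((d + 1) * 2 ^ (2 * (d + 1)) * x.k ^ 2)]
    · simp only [Rejected, not_or, not_lt] at h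
      exact h.2
  size_le := by
    set C := 2 * ((d + 1) * 2 ^ (2 * (d + 1))) + 5
    let q : Polynomial ℕ := Polynomial.C C * (Polynomial.X ^ 2 + 1)
    refine ⟨Polynomial.X + 1 + q * 2 * (q + 1) +
      Polynomial.C (encodeBlocks (Ctx.word trivialNo)).length, ?_⟩
    intro x _
    change (encodeBlocks (Ctx.word (kernel C x))).length ≤ Polynomial.eval x.k _
    have hq : q.eval x.k = C * (x.k ^ 2 + 1) := by simp [q]
    simp only [Polynomial.eval_add, Polynomial.eval_mul, Polynomial.eval_X, Polynomial.eval_one,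
      Polynomial.eval_C, Polynomial.eval_ofNat, hq]
    unfold kernel
    split_ifs with h
    · exact Nat.le_add_left _ _
    · simp only [Rejected, not_or, not_lt] at h
      replace h := h.2
      simp only [Ctx.word]
      rw [encodeBlocks_cons, List.length_append, List.length_map, List.length_cons]
      have h₁ := length_encodeNat_le x.k
      have h₂ := length_encodeBlocks_le (L := (List.finRange _).flatMap fun i =>
        [Computability.encodeNat (x.newCap (x.G.graph.keptEmbedding x.cap x.k i)),
          adjRow (x.G.graph.comap (x.G.graph.keptEmbedding x.cap x.k)) i])
        (B := (x.G.graph.keptList x.cap x.k).length) (by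
          intro b hb
          obtain ⟨i, -, hb⟩ := List.mem_flatMap.1 hb
          rcases List.mem_pair.1 hb with rfl | rfl
          · exact (length_encodeNat_le _).trans (min_le_right _ _)
          · exact (length_adjRow _ _).le)
      have hlen : ((List.finRange (x.G.graph.keptList x.cap x.k).length).flatMap fun i =>
          [Computability.encodeNat (x.newCap (x.G.graph.keptEmbedding x.cap x.k i)),
            adjRow (x.G.graph.comap (x.G.graph.keptEmbedding x.cap x.k)) i]).length =
          (x.G.graph.keptList x.cap x.k).length * 2 := by
        simp [List.length_flatMap]
      rw [hlen] at h₂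
      have h₃ := h₂.trans (Nat.mul_le_mul (Nat.mul_le_mul_right 2 h) (Nat.succ_le_succ h))
      simp only [Nat.succ_eq_add_one] at h₃
      omega
  induced := by
    intro x hx
    change Nonempty ((kernel _ x).G.graph ↪g x.G.graph)
    by_cases h : x.Rejected (2 * ((d + 1) * 2 ^ (2 * (d + 1))) + 5)
    · rw [show kernel _ x = _ from if_pos h]
      exact nonempty_embedding_of_not_yes (not_yes_of_rejected (hd _ hx) h)
    · rw [show kernel _ x = _ from if_neg h]
      exact ⟨SimpleGraph.Embedding.comap _ _⟩

end CapacitatedVCInstance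

theorem theorem2 (𝒞 : Set FinGraph) (h𝒞 : BoundedTwinWidth 𝒞) :
    connectedVertexCover.AdmitsQuadraticVertexKernel 𝒞 ∧
      capacitatedVertexCover.AdmitsQuadraticVertexKernel 𝒞 := by
  obtain ⟨d, hd⟩ := h𝒞
  exact ⟨⟨_, _, ConnectedVCInstance.isKernel_kernel hd⟩,
    ⟨_, _, CapacitatedVCInstance.isKernel_kernel hd⟩⟩
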